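/- Let $G=\sum_{k=0}^\infty \frac{(-1)^k}{(2k+1)^2}$ be Catalan's constant. The six functions $$\frac{\arctan x\,\ln(1+x)}{x},\quad \frac{\arctan x\,\ln(1-x)}{x},\quad \frac{\arctan x\,\ln(1+x^2)}{x},\quad \frac{x\arctan x\,\ln x}{1+x^2},\quad \frac{x\arctan x\,\ln(1+x^2)}{1+x^2},\quad \frac{\ln x\,\ln(1+x^2)}{1+x^2}$$ are integrable on $(0,1)$, and the following seventeen identities hold. (a) Vălean's integrals $\mathcal V_1,\dots,\mathcal V_4$: 1. $$2\int_0^1 \frac{\arctan x\,\ln(1+x)}{x}\,dx+\int_0^1 \frac{\arctan x\,\ln(1+x^2)}{x}\,dx+4\int_0^1 \frac{x\arctan x\,\ln x}{1+x^2}\,dx = 4G\ln 2-\frac{\pi^3}{16}.$$ 2. $$\int_0^1 \frac{\arctan x\,\ln(1+x^2)}{x}\,dx-2\int_0^1 \frac{x\arctan x\,\ln(1+x^2)}{1+x^2}\,dx+2\int_0^1 \frac{x\arctan x\,\ln x}{1+x^2}\,dx = \frac{3\pi}{8}\ln^2 2-\frac{\pi^3}{48}.$$ 3. $$\int_0^1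 \frac{\arctan x\,\ln(1-x)}{x}\,dx+\int_0^1 \frac{\arctan x\,\ln(1+x)}{x}\,dx+2\int_0^1 \frac{x\arctan x\,\ln x}{1+x^2}\,dx = 2G\ln 2-\frac{\pi^3}{16}.$$ 4. $$\int_0^1 \frac{\arctan x\,\ln(1+x^2)}{x}\,dx+2\int_0^1 \frac{x\arctan x\,\ln(1+x^2)}{1+x^2}\,dx = 2G\ln 2-\frac{3\pi}{8}\ln^2 2-\frac{\pi^3}{96}.$$ (b) Thirteen further relations: 1. $$\frac{32}{3}\int_0^1 \frac{\arctan x\,\ln(1+x)}{x}\,dx-32\int_0^1 \frac{\arctan x\,\ln(1-x)}{x}\,dx = \pi^3.$$ 2. $$3\int_0^1 \frac{\arctan x\,\ln(1+x^2)}{x}\,dx-2\int_0^1 \frac{\arctan x\,\ln(1+x)}{x}\,dx = 0.$$ 3. $$16\int_0^1 \frac{\arctan x\,\ln(1+x^2)}{x}\,dx-32\int_0^1 \frac{\arctan x\,\ln(1-x)}{x}\,dx = \pi^3.$$ 4. $$6\int_0^1 \frac{x\arctan x\,\ln x}{1+x^2}\,dx+4\int_0^1 \frac{\arctan x\,\ln(1+x)}{x}\,dx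 = -\frac{3\pi^3}{32}+6G\ln 2.$$ 5. $$\int_0^1 \frac{x\arctan x\,\ln x}{1+x^2}\,dx+\int_0^1 \frac{\arctan x\,\ln(1+x^2)}{x}\,dx = -\frac{\pi^3}{64}+G\ln 2.$$ 6. $$\int_0^1 \frac{x\arctan x\,\ln x}{1+x^2}\,dx+2\int_0^1 \frac{\arctan x\,\ln(1-x)}{x}\,dx = -\frac{5\pi^3}{64}+G\ln 2.$$ 7. $$3\int_0^1 \frac{\ln x\,\ln(1+x^2)}{1+x^2}\,dx-2\int_0^1 \frac{\arctan x\,\ln(1+x)}{x}\,dx = -6G\ln 2+\frac{3\pi^3}{32}.$$ 8. $$\int_0^1 \frac{\ln x\,\ln(1+x^2)}{1+x^2}\,dx-\int_0^1 \frac{\arctan x\,\ln(1+x^2)}{x}\,dx = -2G\ln 2+\frac{\pi^3}{32}.$$ 9. $$\int_0^1 \frac{\ln x\,\ln(1+x^2)}{1+x^2}\,dx-2\int_0^1 \frac{\arctan x\,\ln(1-x)}{x}\,dx = -2G\ln 2+\frac{3\pi^3}{32}.$$ 10. $$\int_0^1 \frac{\arctan x\,\ln(1+x)}{x}\,dx+3\int_0^1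 \frac{x\arctan x\,\ln(1+x^2)}{1+x^2}\,dx = 3G\ln 2-\frac{\pi^3}{64}-\frac{9\pi}{16}\ln^2 2.$$ 11. $$\int_0^1 \frac{\arctan x\,\ln(1-x)}{x}\,dx+\int_0^1 \frac{x\arctan x\,\ln(1+x^2)}{1+x^2}\,dx = G\ln 2-\frac{7\pi^3}{192}-\frac{3\pi}{16}\ln^2 2.$$ 12. $$\int_0^1 \frac{\ln x\,\ln(1+x^2)}{1+x^2}\,dx+\int_0^1 \frac{x\arctan x\,\ln x}{1+x^2}\,dx = -G\ln 2+\frac{\pi^3}{64}.$$ 13. $$2\int_0^1 \frac{x\arctan x\,\ln(1+x^2)}{1+x^2}\,dx-\int_0^1 \frac{x\arctan x\,\ln x}{1+x^2}\,dx = G\ln 2+\frac{\pi^3}{192}-\frac{3\pi}{8}\ln^2 2.$$ -/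

import Mathlib

/-- Catalan's constant `G = ∑_{k ≥ 0} (-1)^k / (2k+1)^2 ≈ 0.91596`. -/
noncomputable def catalanConst : ℝ := ∑' k : ℕ, (-1 : ℝ) ^ k / (2 * (k : ℝ) + 1) ^ 2

/-- The series defining Catalan's constant converges, so the `tsum` above is its genuine sum. -/
theorem hasSum_catalanConst :
    HasSum (fun k : ℕ => (-1 : ℝ) ^ k / (2 * (k : ℝ) + 1) ^ 2) catalanConst := by
  refine Summable.hasSum ?_
  have h := (summable_nat_add_iff 1).2 (Real.summable_one_div_nat_pow.2 one_lt_two)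
  refine Summable.of_norm_bounded h (fun k => ?_)
  rw [norm_div, norm_pow, norm_neg, norm_one, one_pow, norm_pow, Real.norm_eq_abs,
    abs_of_nonneg (by positivity)]
  push_cast
  have hk : (0 : ℝ) ≤ k := Nat.cast_nonneg k
  gcongr
  linarith

/-! ### Primitives of logarithmic kernels on a half-plane, and their behaviour at 0. -/

section LogIntegrals

open Set Filter Topology MeasureTheory

/-! All the evaluations compare line integrals of `log u * (α * log u + δ + β * I) / (u - 1)` along
different curves with common endpoints. The half-plane `im z < re z` is convex and avoids the branch
cut, and the singularity at 1 is removable, so a primitive exists and only the endpoints 0, 1, 2,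
-I, 1 - I matter. With β = 0 the kernel is real on the positive axis, so the imaginary part of the
primitive agrees at 1, at 2 and in the limit at 0 (`im_logPrimitive_ofReal`,
`tendsto_im_logPrimitive_fourthQuadrant`).

The curves are Möbius images of (0, 1), such as 2 / (1 + x I) or (1 + x) / (x + I). On them log u
has real part built from ln x, ln (1 ± x), ln (1 + x²), and imaginary part built from arctan x,
while du / (u - 1) is rational in x. The imaginary part of each line integral is thus a combination
of the integrals sought.

Let a, b, c, d, e, f be the six integrals in order and y = ∫ ln² (1 + x²) / (1 + x²). The curves
give 2a = 3c, 2b = c - π³/16, a formula for c in terms of y, and f - c. Differentiating ln x ·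
arctan x · ln (1 + x²) and arctan x · ln² (1 + x²) gives f + c + 2d = 0 and 4e + y = (π/4) ln² 2.
The seventeen identities are linear consequences of these six relations. -/

/-- The open half-plane `im z < re z`, which avoids the branch cut of the logarithm. -/
def belowDiagonal : Set ℂ := {z | z.im < z.re}

theorem mem_belowDiagonal {z : ℂ} : z ∈ belowDiagonal ↔ z.im < z.re := Iff.rfl

theorem isOpen_belowDiagonal : IsOpen belowDiagonal :=
  isOpen_lt Complex.continuous_im Complex.continuous_re

theorem convex_belowDiagonal : Convex ℝ belowDiagonal := by
  have h := convex_halfSpace_lt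
    (f := Complex.imCLM - Complex.reCLM) (Complex.imCLM - Complex.reCLM).isLinear 0
  have e : belowDiagonal = {w | (Complex.imCLM - Complex.reCLM) w < 0} := by
    ext z
    simp [belowDiagonal]
  rw [e]
  exact h

theorem belowDiagonal_subset_slitPlane : belowDiagonal ⊆ Complex.slitPlane := by
  intro z hz
  rw [mem_belowDiagonal] at hz
  rw [Complex.mem_slitPlane_iff]
  by_contra! h
  linarith [h.1, h.2]

theorem one_mem_belowDiagonal : (1 : ℂ) ∈ belowDiagonal := by simp [mem_belowDiagonal]

theorem ofReal_mem_belowDiagonal {y : ℝ} (hy : 0 < y) : (y : ℂ) ∈ belowDiagonal := by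
  simpa [mem_belowDiagonal] using hy

theorem exists_primitive_belowDiagonal {k : ℂ → ℂ} (hk : DifferentiableOn ℂ k belowDiagonal) :
    ∃ K : ℂ → ℂ, ∀ z ∈ belowDiagonal, HasDerivAt K (k z) z := by
  obtain ⟨K, hK⟩ := convex_belowDiagonal.exists_forall_hasDerivWithinAt hk
  exact ⟨K, fun z hz => (hK z hz).hasDerivAt (isOpen_belowDiagonal.mem_nhds hz)⟩

theorem differentiableOn_log_belowDiagonal : DifferentiableOn ℂ Complex.log belowDiagonal :=
  fun _ hz => (Complex.differentiableAt_log
    (belowDiagonal_subset_slitPlane hz)).differentiableWithinAt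

/-- The function `log u * (a * log u + b) / (u - 1)` with its singularity at `1` removed. -/
noncomputable def logKernel (a b u : ℂ) : ℂ := dslope Complex.log 1 u * (a * Complex.log u + b)

theorem logKernel_of_ne (a b : ℂ) {u : ℂ} (hu : u ≠ 1) :
    logKernel a b u = Complex.log u * (a * Complex.log u + b) / (u - 1) := by
  rw [logKernel, dslope_of_ne _ hu, slope_def_field, Complex.log_one, sub_zero]
  ring

theorem differentiableOn_logKernel (a b : ℂ) :
    DifferentiableOn ℂ (logKernel a b) belowDiagonal := by
  have h1 : DifferentiableOn ℂ (dslope Complex.log 1) belowDiagonal :=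
    (Complex.differentiableOn_dslope (isOpen_belowDiagonal.mem_nhds one_mem_belowDiagonal)).2
      differentiableOn_log_belowDiagonal
  exact h1.mul ((differentiableOn_log_belowDiagonal.const_mul a).add_const b)

/-- The function `(log u) ^ 2 / (u - I)`. -/
noncomputable def logSqKernel (u : ℂ) : ℂ := Complex.log u ^ 2 / (u - Complex.I)

theorem differentiableOn_logSqKernel : DifferentiableOn ℂ logSqKernel belowDiagonal := by
  refine (differentiableOn_log_belowDiagonal.pow 2).div (by fun_prop) fun z hz h => ?_
  rw [sub_eq_zero.1 h, mem_belowDiagonal] at hz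
  simp at hz
  linarith

theorem hasDerivAt_im_primitive_comp {k K : ℂ → ℂ}
    (hK : ∀ z ∈ belowDiagonal, HasDerivAt K (k z) z) {γ : ℝ → ℂ} {γ' : ℂ} {x q : ℝ}
    (hγ : HasDerivAt γ γ' x) (hmem : γ x ∈ belowDiagonal) (hq : (k (γ x) * γ').im = q) :
    HasDerivAt (fun t => (K (γ t)).im) q x := by
  have h := (hK _ hmem).scomp x hγ
  have h2 := Complex.imCLM.hasFDerivAt.comp_hasDerivAt x h
  rw [← hq, mul_comm]
  exact h2

theorem tendsto_im_primitive_comp {k K : ℂ → ℂ}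
    (hK : ∀ z ∈ belowDiagonal, HasDerivAt K (k z) z) {γ : ℝ → ℂ} {x : ℝ} {s : Set ℝ}
    (hγ : ContinuousAt γ x) (hmem : γ x ∈ belowDiagonal) :
    Tendsto (fun t => (K (γ t)).im) (𝓝[s] x) (𝓝 (K (γ x)).im) :=
  (Complex.continuous_im.continuousAt.comp
    ((hK _ hmem).continuousAt.comp hγ)).tendsto.mono_left nhdsWithin_le_nhds

/-- A primitive of a function that is `o(1 / w)` at `0` varies little between `z` and `‖z‖`, for `z`
in the fourth quadrant. -/
theorem tendsto_primitive_sub_primitive_norm {k K : ℂ → ℂ}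
    (hK : ∀ z ∈ belowDiagonal, HasDerivAt K (k z) z)
    (hk : Tendsto (fun w => w * k w) (𝓝[belowDiagonal] 0) (𝓝 0)) :
    Tendsto (fun z : ℂ => K z - K (‖z‖ : ℝ)) (𝓝[{z | 0 ≤ z.re ∧ z.im ≤ 0 ∧ z ≠ 0}] 0) (𝓝 0) := by
  rw [Metric.tendsto_nhdsWithin_nhds] at hk ⊢
  intro ε hε
  -- On the segment ‖w‖ ≥ ‖z‖ / 2, so ‖k w‖ ≤ ε / (4‖z‖); the segment has length at most 2‖z‖, which
  -- gives ε / 2.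
  obtain ⟨δ, hδ, h⟩ := hk (ε / 8) (by positivity)
  refine ⟨δ, hδ, fun z hz hzδ => ?_⟩
  obtain ⟨hre, him, hz0⟩ := hz
  rw [dist_zero_right] at hzδ ⊢
  have hn : 0 < ‖z‖ := norm_pos_iff.2 hz0
  have hzD : z ∈ belowDiagonal := by
    rw [mem_belowDiagonal]
    rcases him.lt_or_eq with h1 | h1
    · linarith
    · rcases hre.lt_or_eq with h2 | h2
      · linarith
      · exact absurd (Complex.ext h2.symm h1) hz0
  have hsub : segment ℝ ((‖z‖ : ℝ) : ℂ) z ⊆ belowDiagonal :=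
    convex_belowDiagonal.segment_subset (ofReal_mem_belowDiagonal hn) hzD
  have hsq : z.re ^ 2 + z.im ^ 2 = ‖z‖ ^ 2 := by
    rw [Complex.sq_norm, Complex.normSq_apply]; ring
  have hbound : ∀ w ∈ segment ℝ ((‖z‖ : ℝ) : ℂ) z, ‖k w‖ ≤ ε / (4 * ‖z‖) := by
    intro w hw
    have hwD := hsub hw
    have hwn : ‖w‖ ≤ ‖z‖ := by
      have := (convex_closedBall (0 : ℂ) ‖z‖).segment_subset (x := ((‖z‖ : ℝ) : ℂ)) (y := z)
        (by simp) (by simp) hw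
      simpa using this
    -- Since `0 ≤ z.re` the cross term is nonnegative, so ‖w‖² ≥ (a² + b²)‖z‖² with a + b = 1: the
    -- segment stays away from 0.
    have hlow : ‖z‖ / 2 ≤ ‖w‖ := by
      obtain ⟨a, b, ha, hb, hab, rfl⟩ := hw
      have e : ‖a • ((‖z‖ : ℝ) : ℂ) + b • z‖ ^ 2 = (a * ‖z‖ + b * z.re) ^ 2 + (b * z.im) ^ 2 := by
        rw [Complex.sq_norm, Complex.normSq_apply]
        simp
        ring
      refine le_of_sq_le_sq ?_ (norm_nonneg _)
      rw [e]
      obtain rfl : a = 1 - b := by linarith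
      have h1 : 0 ≤ (1 - b) * ‖z‖ * (b * z.re) := by positivity
      have h2 : b ^ 2 * (z.re ^ 2 + z.im ^ 2) = b ^ 2 * ‖z‖ ^ 2 := by rw [hsq]
      nlinarith [mul_nonneg (sq_nonneg (2 * b - 1)) (sq_nonneg ‖z‖), sq_nonneg ‖z‖]
    have hlt := h hwD (by rw [dist_zero_right]; linarith)
    rw [dist_zero_right, norm_mul] at hlt
    rw [le_div_iff₀ (by positivity)]
    nlinarith [norm_nonneg (k w)]
  have := Convex.norm_image_sub_le_of_norm_hasDerivWithin_le
    (fun w hw => (hK w (hsub hw)).hasDerivWithinAt) hbound (convex_segment _ _)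
    (left_mem_segment ℝ _ _) (right_mem_segment ℝ _ _)
  have h2 : ‖z - ((‖z‖ : ℝ) : ℂ)‖ ≤ 2 * ‖z‖ := by
    refine (norm_sub_le _ _).trans ?_
    simp
    linarith
  calc ‖K z - K (‖z‖ : ℝ)‖ ≤ ε / (4 * ‖z‖) * ‖z - ((‖z‖ : ℝ) : ℂ)‖ := this
    _ ≤ ε / (4 * ‖z‖) * (2 * ‖z‖) := by gcongr
    _ = ε / 2 := by field_simp; norm_num
    _ < ε := by linarith

/-- Since |log w| ≤ |ln ‖w‖| + π, the real limit t (|ln t| + π)² → 0 suffices; it is the square of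
√t (|ln t| + π) → 0. -/
theorem tendsto_mul_log_sq : Tendsto (fun w : ℂ => w * Complex.log w ^ 2) (𝓝 0) (𝓝 0) := by
  have h1 : Tendsto (fun t : ℝ => t * (|Real.log t| + Real.pi) ^ 2) (𝓝[>] 0) (𝓝 0) := by
    have hl : Tendsto (fun t : ℝ => Real.log t * t ^ (1 / 2 : ℝ)) (𝓝[>] 0) (𝓝 0) :=
      tendsto_log_mul_rpow_nhdsGT_zero (by norm_num)
    have hs : Tendsto (fun t : ℝ => t ^ (1 / 2 : ℝ)) (𝓝[>] 0) (𝓝 0) := by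
      have := (Real.continuousAt_rpow_const 0 (1 / 2 : ℝ) (Or.inr (by norm_num))).tendsto
      rw [Real.zero_rpow (by norm_num)] at this
      exact this.mono_left nhdsWithin_le_nhds
    have := ((hl.abs.add (hs.mul_const Real.pi))).pow 2
    simp only [abs_zero, zero_mul, add_zero, ne_eq, OfNat.ofNat_ne_zero, not_false_eq_true,
      zero_pow] at this
    refine this.congr' ?_
    filter_upwards [self_mem_nhdsWithin] with t ht
    have ht : 0 < t := ht
    have e : (t ^ (1 / 2 : ℝ)) ^ 2 = t := by
      rw [← Real.rpow_natCast, ← Real.rpow_mul ht.le]; norm_num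
    rw [abs_mul, abs_of_pos (Real.rpow_pos_of_pos ht _)]
    linear_combination (|Real.log t| + Real.pi) ^ 2 * e
  have h2 : Tendsto (fun w : ℂ => ‖w‖ * (|Real.log ‖w‖| + Real.pi) ^ 2) (𝓝[≠] 0) (𝓝 0) :=
    h1.comp (tendsto_norm_nhdsNE_zero)
  have h3 : Tendsto (fun w : ℂ => w * Complex.log w ^ 2) (𝓝[≠] 0) (𝓝 0) := by
    refine squeeze_zero_norm (fun w => ?_) h2
    rw [norm_mul, norm_pow]
    gcongr
    refine (Complex.norm_le_abs_re_add_abs_im _).trans ?_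
    rw [Complex.log_re, Complex.log_im]
    gcongr
    exact Complex.abs_arg_le_pi w
  have h4 := (continuousAt_iff_punctured_nhds (f := fun w : ℂ => w * Complex.log w ^ 2)
    (a := 0)).2 (by simpa using h3)
  simpa [ContinuousAt] using h4

theorem tendsto_mul_logKernel :
    Tendsto (fun w => w * logKernel 1 0 w) (𝓝[belowDiagonal] 0) (𝓝 0) := by
  have h1 : Tendsto (fun w : ℂ => w * Complex.log w ^ 2 * (1 / (w - 1))) (𝓝 0)
      (𝓝 (0 * (1 / (0 - 1)))) :=
    tendsto_mul_log_sq.mul (ContinuousAt.tendsto (by fun_prop (disch := norm_num)))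
  rw [zero_mul] at h1
  refine (h1.mono_left nhdsWithin_le_nhds).congr' ?_
  have : ∀ᶠ w : ℂ in 𝓝[belowDiagonal] 0, w ≠ 1 :=
    nhdsWithin_le_nhds (isOpen_ne.mem_nhds zero_ne_one)
  filter_upwards [this] with w hw
  rw [logKernel_of_ne _ _ hw]
  ring

theorem tendsto_mul_logSqKernel :
    Tendsto (fun w => w * logSqKernel w) (𝓝[belowDiagonal] 0) (𝓝 0) := by
  have h1 : Tendsto (fun w : ℂ => w * Complex.log w ^ 2 * (1 / (w - Complex.I))) (𝓝 0)
      (𝓝 (0 * (1 / (0 - Complex.I)))) :=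
    tendsto_mul_log_sq.mul (ContinuousAt.tendsto (by fun_prop (disch := simp)))
  rw [zero_mul] at h1
  refine (h1.mono_left nhdsWithin_le_nhds).congr fun w => ?_
  rw [logSqKernel]
  ring

theorem one_add_mul_I_eq_exp (x : ℝ) :
    1 + x * Complex.I =
      Complex.exp ((Real.log (1 + x ^ 2) / 2 : ℝ) + (Real.arctan x : ℝ) * Complex.I) := by
  have hp : 0 < 1 + x ^ 2 := by positivity
  have h1 : Real.exp (Real.log (1 + x ^ 2) / 2) = √(1 + x ^ 2) := by
    rw [Real.exp_half, Real.exp_log hp]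
  have h2 : √(1 + x ^ 2) ≠ 0 := (Real.sqrt_pos.2 hp).ne'
  rw [Complex.exp_add, Complex.exp_mul_I, ← Complex.ofReal_exp, h1, ← Complex.ofReal_cos,
    ← Complex.ofReal_sin, Real.cos_arctan, Real.sin_arctan]
  apply Complex.ext
  · simp [h2]
  · simp; field_simp

theorem log_eq_of_eq_exp {z : ℂ} {a b : ℝ} (h : z = Complex.exp (a + b * Complex.I))
    (h1 : -Real.pi < b) (h2 : b ≤ Real.pi) : Complex.log z = a + b * Complex.I := by
  rw [h, Complex.log_exp (by simpa using h1) (by simpa using h2)]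

end LogIntegrals

/-! ### Integrals over (0, 1): a calculus of integrable functions with known value. -/

section UnitIntegrals

open Set Filter Topology MeasureTheory

/-- `f` is integrable on `(0, 1)` and its integral there is `v`. -/
def HasUnitIntegral (f : ℝ → ℝ) (v : ℝ) : Prop :=
  IntervalIntegrable f volume 0 1 ∧ ∫ x in (0 : ℝ)..1, f x = v

namespace HasUnitIntegral

variable {f g : ℝ → ℝ} {v w : ℝ}

theorem of_intervalIntegrable (h : IntervalIntegrable f volume 0 1) :
    HasUnitIntegral f (∫ x in (0 : ℝ)..1, f x) := ⟨h, rfl⟩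

theorem add (hf : HasUnitIntegral f v) (hg : HasUnitIntegral g w) :
    HasUnitIntegral (fun x => f x + g x) (v + w) :=
  ⟨hf.1.add hg.1, by rw [intervalIntegral.integral_add hf.1 hg.1, hf.2, hg.2]⟩

theorem const_mul (c : ℝ) (hf : HasUnitIntegral f v) :
    HasUnitIntegral (fun x => c * f x) (c * v) :=
  ⟨hf.1.const_mul c, by rw [intervalIntegral.integral_const_mul, hf.2]⟩

theorem congr (hf : HasUnitIntegral f v) (h : ∀ x ∈ Ioo (0 : ℝ) 1, f x = g x) :
    HasUnitIntegral g v := by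
  have h' : EqOn f g (uIoo 0 1) := by rwa [uIoo_of_le zero_le_one]
  exact ⟨(intervalIntegrable_congr_uIoo h').1 hf.1,
    by rw [← hf.2]; exact (intervalIntegral.integral_congr_uIoo h').symm⟩

theorem eq_sub_of_hasDerivAt {F : ℝ → ℝ} {a b : ℝ} (hf : HasUnitIntegral f v)
    (hF : ∀ x ∈ Ioo (0 : ℝ) 1, HasDerivAt F (f x) x)
    (h0 : Tendsto F (𝓝[>] 0) (𝓝 a)) (h1 : Tendsto F (𝓝[<] 1) (𝓝 b)) : v = b - a := by
  rw [← hf.2, intervalIntegral.integral_eq_sub_of_hasDerivAt_of_tendsto zero_lt_one hF hf.1 h0 h1]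

end HasUnitIntegral

theorem intervalIntegrable_mul_of_bounded {f g : ℝ → ℝ} {C : ℝ}
    (hg : IntervalIntegrable g volume 0 1)
    (hf : ContinuousOn f (Ioo 0 1)) (hb : ∀ x ∈ Ioo (0 : ℝ) 1, |f x| ≤ C) :
    IntervalIntegrable (fun x => f x * g x) volume 0 1 := by
  rw [intervalIntegrable_iff_integrableOn_Ioo_of_le zero_le_one] at hg ⊢
  refine Integrable.bdd_mul (c := C) hg (hf.aestronglyMeasurable measurableSet_Ioo) ?_
  exact (ae_restrict_iff' measurableSet_Ioo).2 (ae_of_all _ hb)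

theorem intervalIntegrable_of_bounded {f : ℝ → ℝ} {C : ℝ}
    (hf : ContinuousOn f (Ioo 0 1)) (hb : ∀ x ∈ Ioo (0 : ℝ) 1, |f x| ≤ C) :
    IntervalIntegrable f volume 0 1 := by
  simpa using intervalIntegrable_mul_of_bounded (g := fun _ => 1) intervalIntegrable_const hf hb

theorem continuousOn_log_Ioo : ContinuousOn Real.log (Ioo 0 1) :=
  Real.continuousOn_log.mono fun _ hx => hx.1.ne'

theorem intervalIntegrable_log_sq :
    IntervalIntegrable (fun x => Real.log x ^ 2) volume 0 1 := by
  have h : IntervalIntegrable (fun x : ℝ => x ^ (-(1 / 2) : ℝ)) volume 0 1 :=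
    intervalIntegral.intervalIntegrable_rpow' (by norm_num)
  -- ln² x = (x^(1/4) ln x)² · x^(-1/2), and |x^(1/4) ln x| < 4 on (0, 1).
  refine (intervalIntegrable_mul_of_bounded (C := 16)
    (f := fun x => (Real.log x * x ^ (1 / 4 : ℝ)) ^ 2) h ?_ ?_).congr_uIoo ?_
  · refine (continuousOn_log_Ioo.mul ?_).pow 2
    exact continuousOn_id.rpow_const fun x hx => Or.inl hx.1.ne'
  · intro x hx
    have := Real.abs_log_mul_self_rpow_lt x (1 / 4) hx.1 hx.2.le (by norm_num)
    rw [abs_pow]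
    nlinarith [abs_nonneg (Real.log x * x ^ (1 / 4 : ℝ))]
  · intro x hx
    rw [uIoo_of_le zero_le_one] at hx
    have e : (x ^ (1 / 4 : ℝ)) ^ 2 * x ^ (-(1 / 2) : ℝ) = 1 := by
      rw [← Real.rpow_natCast, ← Real.rpow_mul hx.1.le, ← Real.rpow_add hx.1]
      norm_num
    simp only [mul_pow]
    linear_combination Real.log x ^ 2 * e

theorem intervalIntegrable_log_one_sub :
    IntervalIntegrable (fun x => Real.log (1 - x)) volume 0 1 := by
  have h : IntervalIntegrable Real.log volume 1 0 := intervalIntegral.intervalIntegrable_log'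
  simpa using h.comp_sub_left 1

/-! ### Elementary bounds by 1 on (0, 1). -/

section bounds

variable {x : ℝ}

theorem arctan_nonneg_of_nonneg (hx : 0 ≤ x) : 0 ≤ Real.arctan x := by
  rw [← Real.arctan_zero]; exact Real.arctan_strictMono.monotone hx

theorem arctan_le_self_of_nonneg (hx : 0 ≤ x) : Real.arctan x ≤ x := by
  by_contra! h
  have h1 := Real.lt_tan (hx.trans_lt h) (Real.arctan_lt_pi_div_two x)
  rw [Real.tan_arctan] at h1
  linarith

theorem log_one_add_sq_nonneg : 0 ≤ Real.log (1 + x ^ 2) := Real.log_nonneg (by nlinarith)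

theorem log_one_add_sq_le_sq : Real.log (1 + x ^ 2) ≤ x ^ 2 := by
  have := Real.log_le_sub_one_of_pos (show 0 < 1 + x ^ 2 by positivity)
  linarith

theorem abs_mul_le_one {a b : ℝ} (ha : |a| ≤ 1) (hb : |b| ≤ 1) : |a * b| ≤ 1 := by
  rw [abs_mul]; exact mul_le_one₀ ha (abs_nonneg b) hb

theorem abs_self_le_one (hx : x ∈ Ioo (0 : ℝ) 1) : |x| ≤ 1 := by
  rw [abs_of_pos hx.1]; exact hx.2.le

theorem abs_arctan_div_le_one (hx : x ∈ Ioo (0 : ℝ) 1) : |Real.arctan x / x| ≤ 1 := by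
  rw [abs_of_nonneg (div_nonneg (arctan_nonneg_of_nonneg hx.1.le) hx.1.le), div_le_one hx.1]
  exact arctan_le_self_of_nonneg hx.1.le

theorem abs_arctan_le_one (hx : x ∈ Ioo (0 : ℝ) 1) : |Real.arctan x| ≤ 1 := by
  rw [abs_of_nonneg (arctan_nonneg_of_nonneg hx.1.le)]
  exact (arctan_le_self_of_nonneg hx.1.le).trans hx.2.le

theorem abs_log_one_add_sq_div_le_one (hx : x ∈ Ioo (0 : ℝ) 1) :
    |Real.log (1 + x ^ 2) / x| ≤ 1 := by
  rw [abs_of_nonneg (div_nonneg log_one_add_sq_nonneg hx.1.le), div_le_one hx.1]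
  nlinarith [log_one_add_sq_le_sq (x := x), hx.1, hx.2]

theorem abs_log_one_add_sq_le_one (hx : x ∈ Ioo (0 : ℝ) 1) : |Real.log (1 + x ^ 2)| ≤ 1 := by
  rw [abs_of_nonneg log_one_add_sq_nonneg]
  nlinarith [log_one_add_sq_le_sq (x := x), hx.1, hx.2]

theorem abs_log_one_add_le_one (hx : x ∈ Ioo (0 : ℝ) 1) : |Real.log (1 + x)| ≤ 1 := by
  rw [abs_of_nonneg (Real.log_nonneg (by linarith [hx.1]))]
  have := Real.log_le_sub_one_of_pos (show 0 < 1 + x by linarith [hx.1])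
  linarith [hx.2]

theorem abs_inv_one_add_sq_le_one : |(1 + x ^ 2)⁻¹| ≤ 1 := by
  rw [abs_of_pos (by positivity)]
  exact inv_le_one_of_one_le₀ (by nlinarith)

end bounds

/-! ### Integrability: a bounded continuous factor times 1, ln x, ln² x or ln (1 - x). -/

theorem continuousOn_log_one_add_sq {s : Set ℝ} :
    ContinuousOn (fun x : ℝ => Real.log (1 + x ^ 2)) s :=
  (Continuous.log (by fun_prop) fun x => by positivity).continuousOn

theorem continuousOn_inv_one_add_sq {s : Set ℝ} :
    ContinuousOn (fun x : ℝ => (1 + x ^ 2)⁻¹) s :=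
  (Continuous.inv₀ (by fun_prop) fun x => by positivity).continuousOn

theorem continuousOn_arctan_div : ContinuousOn (fun x : ℝ => Real.arctan x / x) (Ioo 0 1) :=
  Real.continuous_arctan.continuousOn.div continuousOn_id fun _ hx => hx.1.ne'

theorem intervalIntegrable_arctan_mul_log_one_add_div :
    IntervalIntegrable (fun x => Real.arctan x * Real.log (1 + x) / x) volume 0 1 := by
  have h : ContinuousOn (fun x : ℝ => Real.log (1 + x)) (Ioo 0 1) :=
    ContinuousOn.log (by fun_prop) fun x hx => by linarith [hx.1]
  have := intervalIntegrable_of_bounded (continuousOn_arctan_div.mul h)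
    fun x hx => abs_mul_le_one (abs_arctan_div_le_one hx) (abs_log_one_add_le_one hx)
  exact this.congr_uIoo fun x _ => by simp only [Pi.mul_apply]; ring

theorem intervalIntegrable_arctan_mul_log_one_sub_div :
    IntervalIntegrable (fun x => Real.arctan x * Real.log (1 - x) / x) volume 0 1 := by
  have := intervalIntegrable_mul_of_bounded intervalIntegrable_log_one_sub continuousOn_arctan_div
    fun x hx => abs_arctan_div_le_one hx
  exact this.congr_uIoo fun x _ => by ring

theorem intervalIntegrable_arctan_mul_log_one_add_sq_div :
    IntervalIntegrable (fun x => Real.arctan x * Real.log (1 + x ^ 2) / x) volume 0 1 := by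
  have := intervalIntegrable_of_bounded
    (continuousOn_arctan_div.mul continuousOn_log_one_add_sq)
    fun x hx => abs_mul_le_one (abs_arctan_div_le_one hx) (abs_log_one_add_sq_le_one hx)
  exact this.congr_uIoo fun x _ => by simp only [Pi.mul_apply]; ring

theorem intervalIntegrable_mul_arctan_mul_log_div :
    IntervalIntegrable (fun x => x * Real.arctan x * Real.log x / (1 + x ^ 2)) volume 0 1 := by
  have := intervalIntegrable_mul_of_bounded (intervalIntegral.intervalIntegrable_log' (a := 0))
    ((continuousOn_id.mul Real.continuous_arctan.continuousOn).mul continuousOn_inv_one_add_sq)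
    fun x hx => abs_mul_le_one (abs_mul_le_one (abs_self_le_one hx) (abs_arctan_le_one hx))
      abs_inv_one_add_sq_le_one
  exact this.congr_uIoo fun x _ => by simp only [Pi.mul_apply, id]; ring

theorem intervalIntegrable_mul_arctan_mul_log_one_add_sq_div :
    IntervalIntegrable (fun x => x * Real.arctan x * Real.log (1 + x ^ 2) / (1 + x ^ 2))
      volume 0 1 := by
  have := intervalIntegrable_of_bounded
    (((continuousOn_id.mul Real.continuous_arctan.continuousOn).mul
      continuousOn_inv_one_add_sq).mul continuousOn_log_one_add_sq)
    fun x hx => abs_mul_le_one (abs_mul_le_one (abs_mul_le_one (abs_self_le_one hx)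
      (abs_arctan_le_one hx)) abs_inv_one_add_sq_le_one) (abs_log_one_add_sq_le_one hx)
  exact this.congr_uIoo fun x _ => by simp only [Pi.mul_apply, id]; ring

theorem intervalIntegrable_log_mul_log_one_add_sq_div :
    IntervalIntegrable (fun x => Real.log x * Real.log (1 + x ^ 2) / (1 + x ^ 2)) volume 0 1 := by
  have := intervalIntegrable_mul_of_bounded (intervalIntegral.intervalIntegrable_log' (a := 0))
    (continuousOn_log_one_add_sq.mul continuousOn_inv_one_add_sq)
    fun x hx => abs_mul_le_one (abs_log_one_add_sq_le_one hx) abs_inv_one_add_sq_le_one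
  exact this.congr_uIoo fun x _ => by simp only [Pi.mul_apply]; ring

theorem intervalIntegrable_log_sq_div :
    IntervalIntegrable (fun x => Real.log x ^ 2 / (1 + x ^ 2)) volume 0 1 := by
  have := intervalIntegrable_mul_of_bounded intervalIntegrable_log_sq
    continuousOn_inv_one_add_sq fun x _ => abs_inv_one_add_sq_le_one
  exact this.congr_uIoo fun x _ => by ring

theorem intervalIntegrable_log_div :
    IntervalIntegrable (fun x => Real.log x / (1 + x ^ 2)) volume 0 1 := by
  have := intervalIntegrable_mul_of_bounded (intervalIntegral.intervalIntegrable_log' (a := 0))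
    continuousOn_inv_one_add_sq fun x _ => abs_inv_one_add_sq_le_one
  exact this.congr_uIoo fun x _ => by ring

theorem intervalIntegrable_mul_log_div :
    IntervalIntegrable (fun x => x * Real.log x / (1 + x ^ 2)) volume 0 1 := by
  have := intervalIntegrable_mul_of_bounded (intervalIntegral.intervalIntegrable_log' (a := 0))
    (continuousOn_id.mul continuousOn_inv_one_add_sq)
    fun x hx => abs_mul_le_one (abs_self_le_one hx) abs_inv_one_add_sq_le_one
  exact this.congr_uIoo fun x _ => by simp only [Pi.mul_apply, id]; ring

theorem intervalIntegrable_log_one_add_sq_div_self :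
    IntervalIntegrable (fun x => Real.log (1 + x ^ 2) / x) volume 0 1 :=
  intervalIntegrable_of_bounded
    (continuousOn_log_one_add_sq.div continuousOn_id fun _ hx => hx.1.ne')
    fun _ hx => abs_log_one_add_sq_div_le_one hx

theorem intervalIntegrable_arctan_div :
    IntervalIntegrable (fun x => Real.arctan x / x) volume 0 1 :=
  intervalIntegrable_of_bounded continuousOn_arctan_div fun _ hx => abs_arctan_div_le_one hx

theorem intervalIntegrable_log_one_add_sq_div :
    IntervalIntegrable (fun x => Real.log (1 + x ^ 2) / (1 + x ^ 2)) volume 0 1 := by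
  have := (continuousOn_log_one_add_sq.mul continuousOn_inv_one_add_sq).intervalIntegrable
    (a := 0) (b := 1) (μ := volume)
  exact this.congr_uIoo fun x _ => by simp only [Pi.mul_apply]; ring

theorem intervalIntegrable_log_one_add_sq_sq_div :
    IntervalIntegrable (fun x => Real.log (1 + x ^ 2) ^ 2 / (1 + x ^ 2)) volume 0 1 := by
  have := ((continuousOn_log_one_add_sq.pow 2).mul continuousOn_inv_one_add_sq).intervalIntegrable
    (a := 0) (b := 1) (μ := volume)
  exact this.congr_uIoo fun x _ => by simp only [Pi.mul_apply, Pi.pow_apply]; ring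

theorem intervalIntegrable_arctan_pow_div (n : ℕ) :
    IntervalIntegrable (fun x => Real.arctan x ^ n / (1 + x ^ 2)) volume 0 1 := by
  have := ((Real.continuous_arctan.continuousOn.pow n).mul
    continuousOn_inv_one_add_sq).intervalIntegrable (a := 0) (b := 1) (μ := volume)
  exact this.congr_uIoo fun x _ => by simp only [Pi.mul_apply, Pi.pow_apply]; ring

/-! ### Closed forms from antiderivatives and power series. -/

theorem hasUnitIntegral_arctan_pow_div (n : ℕ) :
    HasUnitIntegral (fun x => Real.arctan x ^ n / (1 + x ^ 2))
      ((Real.pi / 4) ^ (n + 1) / (n + 1)) := by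
  have hn : (n : ℝ) + 1 ≠ 0 := by positivity
  refine ⟨intervalIntegrable_arctan_pow_div n, ?_⟩
  rw [intervalIntegral.integral_eq_sub_of_hasDerivAt
    (f := fun x => Real.arctan x ^ (n + 1) / (n + 1)) (fun x _ => ?_)
    (intervalIntegrable_arctan_pow_div n)]
  · simp
  · refine (((Real.hasDerivAt_arctan x).pow (n + 1)).div_const ((n : ℝ) + 1)).congr_deriv ?_
    have hx : 1 + x ^ 2 ≠ 0 := by positivity
    simp only [Nat.add_sub_cancel]
    push_cast
    field_simp

theorem HasSum.of_eq {f g : ℕ → ℝ} {a b : ℝ} (h : HasSum f a) (hfg : ∀ n, f n = g n)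
    (hab : a = b) : HasSum g b := by
  rwa [← hab, ← funext hfg]

/-- Termwise integration: |c n| / (m n + 1) is the L¹ norm of the n-th term, so `hs` is exactly
absolute convergence in L¹(0, 1). -/
theorem hasSum_unitIntegral_of_hasSum_pow {c : ℕ → ℝ} {m : ℕ → ℕ} {f : ℝ → ℝ}
    (hs : Summable fun n => |c n| / (m n + 1))
    (hf : ∀ x ∈ Ioo (0 : ℝ) 1, HasSum (fun n => c n * x ^ m n) (f x)) :
    HasSum (fun n => c n / (m n + 1)) (∫ x in (0 : ℝ)..1, f x) := by
  have hint : ∀ (a : ℝ) (k : ℕ), ∫ x in Ioo (0 : ℝ) 1, a * x ^ k = a / (k + 1) := by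
    intro a k
    rw [← integral_Ioc_eq_integral_Ioo, ← intervalIntegral.integral_of_le zero_le_one,
      intervalIntegral.integral_const_mul, integral_pow]
    simp
    ring
  have key := hasSum_integral_of_summable_integral_norm (μ := volume.restrict (Ioo (0 : ℝ) 1))
    (F := fun n x => c n * x ^ m n) (fun n => ?_) ?_
  · rw [intervalIntegral.integral_of_le zero_le_one, integral_Ioc_eq_integral_Ioo]
    refine key.of_eq (fun n => hint _ _) ?_
    exact setIntegral_congr_fun measurableSet_Ioo fun x hx => (hf x hx).tsum_eq
  · have : IntervalIntegrable (fun x : ℝ => c n * x ^ m n) volume 0 1 :=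
      Continuous.intervalIntegrable (by fun_prop) _ _
    rwa [intervalIntegrable_iff_integrableOn_Ioo_of_le zero_le_one] at this
  · refine hs.congr fun n => ?_
    rw [← hint]
    refine setIntegral_congr_fun measurableSet_Ioo fun x hx => ?_
    simp [abs_of_pos hx.1]

theorem hasUnitIntegral_arctan_div : HasUnitIntegral (fun x => Real.arctan x / x) catalanConst := by
  refine ⟨intervalIntegrable_arctan_div, ?_⟩
  have h := hasSum_unitIntegral_of_hasSum_pow (c := fun n => (-1) ^ n / (2 * n + 1))
    (m := fun n => 2 * n) (f := fun x => Real.arctan x / x) ?_ ?_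
  · refine h.unique (hasSum_catalanConst.of_eq (fun n => ?_) rfl)
    push_cast
    rw [div_div, sq]
  · refine hasSum_catalanConst.summable.abs.congr fun n => ?_
    have : (0 : ℝ) < 2 * n + 1 := by positivity
    push_cast
    rw [abs_div, abs_div, abs_of_pos this, abs_of_pos (pow_pos this 2), div_div, sq]
  · intro x hx
    have := (Real.hasSum_arctan (x := x)
      (by rw [Real.norm_of_nonneg hx.1.le]; exact hx.2)).div_const x
    refine this.of_eq (fun n => ?_) rfl
    have := hx.1.ne'
    push_cast
    field_simp
    ring

/-- The sum ζ(2) is split by parity of the index. Because of the shift by 1, odd n carry the even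
denominators (2k + 2)², with total ζ(2) / 4. -/
theorem hasSum_alternating_inv_sq :
    HasSum (fun n : ℕ => (-1 : ℝ) ^ n / ((n : ℝ) + 1) ^ 2) (Real.pi ^ 2 / 12) := by
  have hz : HasSum (fun n : ℕ => 1 / ((n : ℝ) + 1) ^ 2) (Real.pi ^ 2 / 6) := by
    have := (hasSum_nat_add_iff' (f := fun n : ℕ => (1 : ℝ) / (n : ℝ) ^ 2) 1).2 hasSum_zeta_two
    simpa using this
  have ho : HasSum (fun k : ℕ => 1 / (((2 * k + 1 : ℕ) : ℝ) + 1) ^ 2) (Real.pi ^ 2 / 24) := by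
    refine (hz.div_const 4).of_eq (fun k => ?_) (by ring)
    push_cast
    field_simp
    ring
  have hs : Summable (fun k : ℕ => 1 / (((2 * k : ℕ) : ℝ) + 1) ^ 2) :=
    hz.summable.comp_injective (i := fun k : ℕ => 2 * k) (mul_right_injective₀ two_ne_zero)
  have he : ∑' k : ℕ, 1 / (((2 * k : ℕ) : ℝ) + 1) ^ 2 = Real.pi ^ 2 / 8 := by
    have := (HasSum.even_add_odd (f := fun n : ℕ => 1 / ((n : ℝ) + 1) ^ 2) hs.hasSum ho).unique hz
    linarith
  have he' : HasSum (fun k : ℕ => (-1 : ℝ) ^ (2 * k) / (((2 * k : ℕ) : ℝ) + 1) ^ 2)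
      (Real.pi ^ 2 / 8) :=
    hs.hasSum.of_eq (fun k => by rw [pow_mul]; norm_num) he
  have ho' : HasSum (fun k : ℕ => (-1 : ℝ) ^ (2 * k + 1) / (((2 * k + 1 : ℕ) : ℝ) + 1) ^ 2)
      (-(Real.pi ^ 2 / 24)) :=
    ho.neg.of_eq (fun k => by rw [pow_succ (-1 : ℝ), pow_mul]; norm_num [neg_div]) rfl
  have := HasSum.even_add_odd (f := fun n : ℕ => (-1 : ℝ) ^ n / ((n : ℝ) + 1) ^ 2) he' ho'
  exact this.of_eq (fun _ => rfl) (by ring)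

theorem hasUnitIntegral_log_one_add_sq_div_self :
    HasUnitIntegral (fun x => Real.log (1 + x ^ 2) / x) (Real.pi ^ 2 / 24) := by
  refine ⟨intervalIntegrable_log_one_add_sq_div_self, ?_⟩
  have h := hasSum_unitIntegral_of_hasSum_pow (c := fun n => (-1) ^ n / ((n : ℝ) + 1))
    (m := fun n => 2 * n + 1) (f := fun x => Real.log (1 + x ^ 2) / x) ?_ ?_
  · refine h.unique ((hasSum_alternating_inv_sq.div_const 2).of_eq (fun n => ?_) (by ring))
    push_cast
    rw [div_div, div_div]
    congr 1
    ring
  · refine (hasSum_alternating_inv_sq.summable.div_const 2).abs.congr fun n => ?_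
    have : (0 : ℝ) < n + 1 := by positivity
    push_cast
    rw [abs_div, abs_div, abs_div, abs_of_pos this, abs_of_pos (pow_pos this 2), abs_two, div_div,
      div_div]
    congr 1
    ring
  · intro x hx
    have hx2 : |-x ^ 2| < 1 := by
      rw [abs_neg, abs_pow, abs_of_pos hx.1]
      exact pow_lt_one₀ hx.1.le hx.2 two_ne_zero
    have := ((Real.hasSum_pow_div_log_of_abs_lt_one hx2).neg).div_const x
    rw [neg_neg, sub_neg_eq_add] at this
    refine this.of_eq (fun n => ?_) rfl
    have := hx.1.ne'
    rw [neg_pow (x ^ 2)]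
    field_simp
    ring

end UnitIntegrals

/-! ### Differentiating the primitives along curves given in exponential form. -/

section LogPaths

open Set Filter Topology MeasureTheory

theorem exp_mem_belowDiagonal {u v : ℝ} (hv : -(Real.pi / 2) ≤ v) (hv' : v ≤ 0) :
    Complex.exp (u + v * Complex.I) ∈ belowDiagonal := by
  rw [mem_belowDiagonal, Complex.exp_im, Complex.exp_re]
  simp only [Complex.add_re, Complex.ofReal_re, Complex.mul_re, Complex.I_re, mul_zero,
    Complex.ofReal_im, Complex.I_im, mul_one, sub_self, add_zero, Complex.add_im, Complex.mul_im,
    zero_add]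
  refine mul_lt_mul_of_pos_left ?_ (Real.exp_pos u)
  rcases hv'.lt_or_eq with h | rfl
  · exact (Real.sin_neg_of_neg_of_neg_pi_lt h (by linarith [Real.pi_pos])).trans_le
      (Real.cos_nonneg_of_mem_Icc ⟨hv, by linarith [Real.pi_pos]⟩)
  · simp

/-- A primitive of `logKernel α (δ + β * I)` on `belowDiagonal`. -/
noncomputable def logPrimitive (α δ β : ℝ) : ℂ → ℂ :=
  (exists_primitive_belowDiagonal
    (differentiableOn_logKernel (α : ℂ) (δ + β * Complex.I))).choose

theorem hasDerivAt_logPrimitive (α δ β : ℝ) : ∀ z ∈ belowDiagonal,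
    HasDerivAt (logPrimitive α δ β) (logKernel α (δ + β * Complex.I) z) z :=
  (exists_primitive_belowDiagonal
    (differentiableOn_logKernel (α : ℂ) (δ + β * Complex.I))).choose_spec

/-- A primitive of `logSqKernel` on `belowDiagonal`. -/
noncomputable def logSqPrimitive : ℂ → ℂ :=
  (exists_primitive_belowDiagonal differentiableOn_logSqKernel).choose

theorem hasDerivAt_logSqPrimitive : ∀ z ∈ belowDiagonal,
    HasDerivAt logSqPrimitive (logSqKernel z) z :=
  (exists_primitive_belowDiagonal differentiableOn_logSqKernel).choose_spec

section paths

variable {α δ β : ℝ}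

/-- Writing γ' = (r + s I)(γ - 1) cancels the denominator of the kernel, leaving a polynomial in log
γ = u + v I. The strict inequality v < 0 keeps γ away from 1. -/
theorem hasDerivAt_im_logPrimitive_comp {γ : ℝ → ℂ} {x u v r s : ℝ}
    (hexp : γ x = Complex.exp (u + v * Complex.I)) (hv : -(Real.pi / 2) ≤ v) (hv' : v < 0)
    (hγ : HasDerivAt γ ((r + s * Complex.I) * (γ x - 1)) x) :
    HasDerivAt (fun t => (logPrimitive α δ β (γ t)).im)
      ((α * (u ^ 2 - v ^ 2) + δ * u - β * v) * s + (2 * α * u * v + δ * v + β * u) * r) x := by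
  have hlog : Complex.log (γ x) = u + v * Complex.I :=
    log_eq_of_eq_exp hexp (by linarith [Real.pi_pos]) (by linarith [Real.pi_pos])
  have hne : γ x ≠ 1 := by
    intro h
    rw [h, Complex.log_one] at hlog
    have := congrArg Complex.im hlog
    simp at this
    exact hv'.ne this.symm
  refine hasDerivAt_im_primitive_comp (hasDerivAt_logPrimitive α δ β) hγ
    (hexp ▸ exp_mem_belowDiagonal hv hv'.le) ?_
  rw [logKernel_of_ne _ _ hne, hlog]
  have h1 : γ x - 1 ≠ 0 := sub_ne_zero.2 hne
  rw [div_mul_eq_mul_div, mul_comm (_ + _ * Complex.I) (γ x - 1), mul_left_comm,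
    mul_div_cancel_left₀ _ h1]
  simp
  ring

theorem eq_sub_of_logPath {γ : ℝ → ℂ} {u v r s : ℝ → ℝ} {q a b : ℝ}
    (hexp : ∀ x ∈ Ioo (0 : ℝ) 1, γ x = Complex.exp (u x + v x * Complex.I))
    (hv : ∀ x ∈ Ioo (0 : ℝ) 1, -(Real.pi / 2) ≤ v x ∧ v x < 0)
    (hγ : ∀ x ∈ Ioo (0 : ℝ) 1, HasDerivAt γ ((r x + s x * Complex.I) * (γ x - 1)) x)
    (h0 : Tendsto (fun t => (logPrimitive α δ β (γ t)).im) (𝓝[>] 0) (𝓝 a))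
    (h1 : Tendsto (fun t => (logPrimitive α δ β (γ t)).im) (𝓝[<] 1) (𝓝 b))
    (hq : HasUnitIntegral (fun x => (α * (u x ^ 2 - v x ^ 2) + δ * u x - β * v x) * s x
      + (2 * α * u x * v x + δ * v x + β * u x) * r x) q) : q = b - a :=
  hq.eq_sub_of_hasDerivAt (fun x hx =>
    hasDerivAt_im_logPrimitive_comp (hexp x hx) (hv x hx).1 (hv x hx).2 (hγ x hx)) h0 h1

theorem tendsto_im_logPrimitive_comp {γ : ℝ → ℂ} {x : ℝ} {z : ℂ} {s : Set ℝ}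
    (hγ : ContinuousAt γ x) (hz : γ x = z) (hmem : z ∈ belowDiagonal) :
    Tendsto (fun t => (logPrimitive α δ β (γ t)).im) (𝓝[s] x)
      (𝓝 (logPrimitive α δ β z).im) := by
  subst hz
  exact tendsto_im_primitive_comp (hasDerivAt_logPrimitive α δ β) hγ hmem

end paths

theorem arctan_mem_of_mem_Ioo {x : ℝ} (hx : x ∈ Ioo (0 : ℝ) 1) :
    0 < Real.arctan x ∧ Real.arctan x < Real.pi / 4 := by
  rw [← Real.arctan_zero, ← Real.arctan_one]
  exact ⟨Real.arctan_strictMono hx.1, Real.arctan_strictMono hx.2⟩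

theorem one_add_mul_I_ne_zero (x : ℝ) : (1 : ℂ) + x * Complex.I ≠ 0 := by
  rw [one_add_mul_I_eq_exp]; exact Complex.exp_ne_zero _

theorem one_sub_mul_I_eq_exp (x : ℝ) : 1 - x * Complex.I =
    Complex.exp ((Real.log (1 + x ^ 2) / 2 : ℝ) + (-Real.arctan x : ℝ) * Complex.I) := by
  have := one_add_mul_I_eq_exp (-x)
  rw [neg_sq, Real.arctan_neg] at this
  rw [← this]
  push_cast
  ring

theorem add_I_eq (x : ℝ) : (x : ℂ) + Complex.I = Complex.I * (1 - x * Complex.I) := by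
  linear_combination (x : ℂ) * Complex.I_sq

theorem add_I_ne_zero (x : ℝ) : (x : ℂ) + Complex.I ≠ 0 := by
  rw [add_I_eq, one_sub_mul_I_eq_exp]
  exact mul_ne_zero Complex.I_ne_zero (Complex.exp_ne_zero _)

theorem ofReal_div_one_add_mul_I_eq_exp {p : ℝ} (hp : 0 < p) (x : ℝ) :
    (p : ℂ) / (1 + x * Complex.I) = Complex.exp
      ((Real.log p - Real.log (1 + x ^ 2) / 2 : ℝ) + (-Real.arctan x : ℝ) * Complex.I) := by
  rw [one_add_mul_I_eq_exp]
  nth_rw 1 [← Real.exp_log hp]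
  rw [Complex.ofReal_exp, ← Complex.exp_sub]
  congr 1
  push_cast
  ring

theorem ofReal_div_add_I_eq_exp {p : ℝ} (hp : 0 < p) (x : ℝ) :
    (p : ℂ) / (x + Complex.I) = Complex.exp ((Real.log p - Real.log (1 + x ^ 2) / 2 : ℝ)
      + (Real.arctan x - Real.pi / 2 : ℝ) * Complex.I) := by
  rw [add_I_eq, one_sub_mul_I_eq_exp]
  have hI : Complex.I = Complex.exp ((Real.pi / 2 : ℝ) * Complex.I) := by
    push_cast
    exact Complex.exp_pi_div_two_mul_I.symm
  nth_rw 1 [← Real.exp_log hp]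
  rw [Complex.ofReal_exp]
  conv_lhs => rw [hI]
  rw [← Complex.exp_add, ← Complex.exp_sub, ← hI]
  congr 1
  push_cast
  ring

theorem hasDerivAt_ofReal' (x : ℝ) : HasDerivAt (fun t : ℝ => (t : ℂ)) 1 x :=
  Complex.ofRealCLM.hasDerivAt

theorem one_add_sq_ne_zero (x : ℝ) : (1 : ℂ) + (x : ℂ) ^ 2 ≠ 0 := by
  exact_mod_cast (show 1 + x ^ 2 ≠ 0 by positivity)

theorem inv_one_add_mul_I (x : ℝ) :
    ((1 : ℂ) + x * Complex.I)⁻¹ = (1 - x * Complex.I) / (1 + (x : ℂ) ^ 2) := by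
  have := one_add_mul_I_ne_zero x
  have := one_add_sq_ne_zero x
  field_simp
  linear_combination ((x : ℂ) ^ 2) * Complex.I_sq

/-- Derivative of a path of the form `(a + b x) / (1 + x I)`, with the value written relative to
its displacement from `c`. -/
theorem hasDerivAt_div_one_add_mul_I {a b c w : ℂ} (x : ℝ)
    (h : b - a * Complex.I = w * (a + b * x - c * (1 + x * Complex.I)) * (1 + x * Complex.I)) :
    HasDerivAt (fun t : ℝ => (a + b * t) / (1 + t * Complex.I))
      (w * ((a + b * x) / (1 + x * Complex.I) - c)) x := by
  have hne := one_add_mul_I_ne_zero x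
  refine ((((hasDerivAt_ofReal' x).const_mul b).const_add a).div
    (((hasDerivAt_ofReal' x).mul_const Complex.I).const_add 1) hne).congr_deriv ?_
  field_simp
  linear_combination h

theorem hasDerivAt_div_add_I {a b c w : ℂ} (x : ℝ)
    (h : b * Complex.I - a = w * (a + b * x - c * (x + Complex.I)) * (x + Complex.I)) :
    HasDerivAt (fun t : ℝ => (a + b * t) / (t + Complex.I))
      (w * ((a + b * x) / (x + Complex.I) - c)) x := by
  have hne := add_I_ne_zero x
  refine ((((hasDerivAt_ofReal' x).const_mul b).const_add a).div
    ((hasDerivAt_ofReal' x).add_const Complex.I) hne).congr_deriv ?_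
  field_simp
  linear_combination h

end LogPaths

/-! ### Curves with both endpoints inside the half-plane. -/

section LogPathIntegrals

open Set Filter Topology MeasureTheory

theorem one_sub_I_mem_belowDiagonal : 1 - Complex.I ∈ belowDiagonal := by
  simp [mem_belowDiagonal]

theorem neg_I_mem_belowDiagonal : -Complex.I ∈ belowDiagonal := by
  simp [mem_belowDiagonal]

theorem two_mem_belowDiagonal : (2 : ℂ) ∈ belowDiagonal := by
  simp [mem_belowDiagonal]

theorem one_div_one_add_I : (1 : ℂ) / (1 + Complex.I) = (1 - Complex.I) / 2 := by
  have := inv_one_add_mul_I 1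
  norm_num at this
  rw [one_div, this]

theorem continuousAt_div_one_add_mul_I (a b : ℂ) (x : ℝ) :
    ContinuousAt (fun t : ℝ => (a + b * t) / (1 + t * Complex.I)) x :=
  ContinuousAt.div (by fun_prop) (by fun_prop) (one_add_mul_I_ne_zero x)

theorem continuousAt_div_add_I (a b : ℂ) (x : ℝ) :
    ContinuousAt (fun t : ℝ => (a + b * t) / (t + Complex.I)) x :=
  ContinuousAt.div (by fun_prop) (by fun_prop) (add_I_ne_zero x)

section general

variable {α δ β q : ℝ}

/-- On γ = 1 - x I, dγ / (γ - 1) = dx / x. -/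
theorem logPath_vertical
    (hq : HasUnitIntegral (fun x => (2 * α * (Real.log (1 + x ^ 2) / 2) * (-Real.arctan x)
      + δ * (-Real.arctan x) + β * (Real.log (1 + x ^ 2) / 2)) * (1 / x)) q) :
    q = (logPrimitive α δ β (1 - Complex.I)).im - (logPrimitive α δ β 1).im := by
  have hc : ∀ x : ℝ, HasDerivAt (fun t : ℝ => 1 - (t : ℂ) * Complex.I) (-Complex.I) x := fun x => by
    simpa using ((hasDerivAt_ofReal' x).mul_const Complex.I).const_sub 1
  refine eq_sub_of_logPath (γ := fun t : ℝ => 1 - t * Complex.I) (r := fun x => 1 / x)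
    (s := fun _ => 0) (fun x _ => one_sub_mul_I_eq_exp x) (fun x hx => ?_) (fun x hx => ?_)
    (tendsto_im_logPrimitive_comp (hc 0).continuousAt (by simp) one_mem_belowDiagonal)
    (tendsto_im_logPrimitive_comp (hc 1).continuousAt (by simp) one_sub_I_mem_belowDiagonal)
    (hq.congr fun x _ => by simp only [mul_zero, zero_add])
  · have := arctan_mem_of_mem_Ioo hx
    constructor <;> linarith
  · refine (hc x).congr_deriv ?_
    have : (x : ℂ) ≠ 0 := Complex.ofReal_ne_zero.2 hx.1.ne'
    push_cast
    field_simp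
    ring

/-- For γ = 2 / (1 + x I), γ - 1 = (1 - x I) / (1 + x I) has modulus 1, so dγ / (γ - 1) is purely
imaginary and r = 0. -/
theorem logPath_two_div
    (hq : HasUnitIntegral (fun x =>
      (α * ((Real.log 2 - Real.log (1 + x ^ 2) / 2) ^ 2 - (-Real.arctan x) ^ 2)
      + δ * (Real.log 2 - Real.log (1 + x ^ 2) / 2) - β * (-Real.arctan x))
        * (-2 / (1 + x ^ 2))) q) :
    q = (logPrimitive α δ β (1 - Complex.I)).im - (logPrimitive α δ β 2).im := by
  refine eq_sub_of_logPath (γ := fun t : ℝ => (2 + 0 * t) / (1 + t * Complex.I))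
    (u := fun x => Real.log 2 - Real.log (1 + x ^ 2) / 2) (v := fun x => -Real.arctan x)
    (r := fun x => 0) (s := fun x => -2 / (1 + x ^ 2))
    (fun x _ => ?_) (fun x hx => ?_) (fun x hx => ?_)
    (tendsto_im_logPrimitive_comp (continuousAt_div_one_add_mul_I _ _ 0) (by simp)
      two_mem_belowDiagonal)
    (tendsto_im_logPrimitive_comp (continuousAt_div_one_add_mul_I _ _ 1) ?_
      one_sub_I_mem_belowDiagonal)
    (hq.congr fun x _ => by simp only [mul_zero, add_zero])
  · rw [← ofReal_div_one_add_mul_I_eq_exp two_pos]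
    simp
  · have := arctan_mem_of_mem_Ioo hx
    constructor <;> linarith
  · apply hasDerivAt_div_one_add_mul_I
    have := one_add_sq_ne_zero x
    push_cast
    field_simp
    linear_combination (-2 * Complex.I * x ^ 2) * Complex.I_sq
  · have := one_div_one_add_I
    simp only [zero_mul, add_zero, Complex.ofReal_one, one_mul]
    linear_combination 2 * this

/-- γ = (1 - x I) / (1 + x I) runs along the unit circle, where log γ = -2 I arctan x. For δ = 0
only powers of arctan x remain, so the integral is elementary. -/
theorem logPath_unit_arc
    (hq : HasUnitIntegral (fun x => (α * (0 ^ 2 - (-2 * Real.arctan x) ^ 2) + δ * 0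
      - β * (-2 * Real.arctan x)) * (-1 / (1 + x ^ 2)) + (δ * (-2 * Real.arctan x))
        * (1 / (x * (1 + x ^ 2)))) q) :
    q = (logPrimitive α δ β (-Complex.I)).im - (logPrimitive α δ β 1).im := by
  refine eq_sub_of_logPath (γ := fun t : ℝ => (1 + (-Complex.I) * t) / (1 + t * Complex.I))
    (u := fun _ => 0) (v := fun x => -2 * Real.arctan x)
    (r := fun x => 1 / (x * (1 + x ^ 2))) (s := fun x => -1 / (1 + x ^ 2))
    (fun x _ => ?_) (fun x hx => ?_) (fun x hx => ?_)
    (tendsto_im_logPrimitive_comp (continuousAt_div_one_add_mul_I _ _ 0) (by simp)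
      one_mem_belowDiagonal)
    (tendsto_im_logPrimitive_comp (continuousAt_div_one_add_mul_I _ _ 1) ?_
      neg_I_mem_belowDiagonal)
    (hq.congr fun x _ => by ring)
  · have e := one_sub_mul_I_eq_exp x
    have : (1 : ℂ) + (-Complex.I) * x = 1 - x * Complex.I := by ring
    rw [this, e, one_add_mul_I_eq_exp, ← Complex.exp_sub]
    congr 1
    push_cast
    ring
  · have := arctan_mem_of_mem_Ioo hx
    constructor <;> linarith
  · apply hasDerivAt_div_one_add_mul_I
    have := one_add_sq_ne_zero x
    have : (x : ℂ) ≠ 0 := Complex.ofReal_ne_zero.2 hx.1.ne'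
    push_cast
    field_simp
    linear_combination (-2 * x ^ 3 * Complex.I) * Complex.I_sq
  · have := one_div_one_add_I
    simp only [Complex.ofReal_one, one_mul, mul_one]
    linear_combination (1 - Complex.I) * this + (1 / 2) * Complex.I_sq

end general

/-- The sum of the path integrals along `(1 + x) / (1 + x I)` and `(1 + x) / (x + I)`. -/
theorem logPath_one_add_div {q : ℝ}
    (hq : HasUnitIntegral (fun x => -2 * (Real.log (1 + x) - Real.log (1 + x ^ 2) / 2)
      * Real.arctan x / x + Real.pi ^ 2 / 4 / (1 + x ^ 2)) q) :
    q = (logPrimitive 1 0 0 (1 - Complex.I)).im - (logPrimitive 1 0 0 1).im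
      + ((logPrimitive 1 0 Real.pi (1 - Complex.I)).im
        - (logPrimitive 1 0 Real.pi (-Complex.I)).im) := by
  have h4 : ∀ x ∈ Ioo (0 : ℝ) 1, HasDerivAt (fun t : ℝ => (logPrimitive 1 0 0
      ((1 + 1 * t) / (1 + t * Complex.I))).im) _ x := fun x hx => by
    refine hasDerivAt_im_logPrimitive_comp
      (γ := fun t : ℝ => (1 + 1 * t) / (1 + t * Complex.I))
      (u := Real.log (1 + x) - Real.log (1 + x ^ 2) / 2) (v := -Real.arctan x)
      (r := 1 / (x * (1 + x ^ 2))) (s := -1 / (1 + x ^ 2)) ?_ ?_ ?_ ?_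
    · rw [← ofReal_div_one_add_mul_I_eq_exp (by linarith [hx.1])]
      simp
    · have := arctan_mem_of_mem_Ioo hx
      linarith
    · have := arctan_mem_of_mem_Ioo hx
      linarith
    · apply hasDerivAt_div_one_add_mul_I
      have := one_add_sq_ne_zero x
      have : (x : ℂ) ≠ 0 := Complex.ofReal_ne_zero.2 hx.1.ne'
      push_cast
      field_simp
      linear_combination (x ^ 3 * (1 - Complex.I)) * Complex.I_sq
  -- β = π compensates the shift -π/2 in the argument: with v = θ - π/2 and θ = arctan x, 2uv + πu =
  -- 2uθ and v² + πv = θ² - π²/4. Added to the first curve, the terms in u² and θ² cancel, and 1 /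
  -- (x (1 + x²)) + x / (1 + x²) = 1 / x.
  have h5 : ∀ x ∈ Ioo (0 : ℝ) 1, HasDerivAt (fun t : ℝ => (logPrimitive 1 0 Real.pi
      ((1 + 1 * t) / (t + Complex.I))).im) _ x := fun x hx => by
    refine hasDerivAt_im_logPrimitive_comp
      (γ := fun t : ℝ => (1 + 1 * t) / (t + Complex.I))
      (u := Real.log (1 + x) - Real.log (1 + x ^ 2) / 2) (v := Real.arctan x - Real.pi / 2)
      (r := -x / (1 + x ^ 2)) (s := 1 / (1 + x ^ 2)) ?_ ?_ ?_ ?_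
    · rw [← ofReal_div_add_I_eq_exp (by linarith [hx.1])]
      simp
    · have := arctan_mem_of_mem_Ioo hx
      linarith
    · have := arctan_mem_of_mem_Ioo hx
      linarith
    · apply hasDerivAt_div_add_I
      have := one_add_sq_ne_zero x
      push_cast
      field_simp
      linear_combination (Complex.I - 1) * Complex.I_sq
  have key := hq.eq_sub_of_hasDerivAt
    (fun x hx => ((h4 x hx).add (h5 x hx)).congr_deriv ?_)
    ((tendsto_im_logPrimitive_comp (continuousAt_div_one_add_mul_I 1 1 0) (by simp)
      one_mem_belowDiagonal).add (tendsto_im_logPrimitive_comp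
        (continuousAt_div_add_I 1 1 0) (by simp) neg_I_mem_belowDiagonal))
    ((tendsto_im_logPrimitive_comp (continuousAt_div_one_add_mul_I 1 1 1) (z := 1 - Complex.I) ?_
      one_sub_I_mem_belowDiagonal).add (tendsto_im_logPrimitive_comp
        (continuousAt_div_add_I 1 1 1) (z := 1 - Complex.I) ?_ one_sub_I_mem_belowDiagonal))
  · rw [key]
    ring
  · have h0 := hx.1.ne'
    have : 1 + x ^ 2 ≠ 0 := by positivity
    field_simp
    ring
  · have := one_div_one_add_I
    simp only [Complex.ofReal_one, one_mul, mul_one]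
    linear_combination 2 * this
  · have := one_div_one_add_I
    simp only [Complex.ofReal_one, mul_one]
    linear_combination 2 * this

/-- With β = 0 the kernel is real on the positive axis, so the imaginary part of its primitive has
zero derivative there. -/
theorem im_logPrimitive_ofReal (α δ : ℝ) {y : ℝ} (hy : 0 < y) :
    (logPrimitive α δ 0 y).im = (logPrimitive α δ 0 1).im := by
  have hd : ∀ t ∈ Ioi (0 : ℝ), HasDerivAt (fun t : ℝ => (logPrimitive α δ 0 t).im) 0 t := by
    intro t ht
    refine hasDerivAt_im_primitive_comp (hasDerivAt_logPrimitive α δ 0) (hasDerivAt_ofReal' t)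
      (ofReal_mem_belowDiagonal ht) ?_
    by_cases h1 : t = 1
    · subst h1
      simp [logKernel, (Complex.hasDerivAt_log Complex.one_mem_slitPlane).deriv]
    · rw [logKernel_of_ne _ _ (by exact_mod_cast h1), ← Complex.ofReal_log (le_of_lt ht)]
      have e : (Real.log t : ℂ) * ((α : ℂ) * Real.log t + (δ + ((0 : ℝ) : ℂ) * Complex.I))
          / (t - 1) * 1 = ((Real.log t * (α * Real.log t + δ) / (t - 1) : ℝ) : ℂ) := by
        push_cast
        ring
      rw [e, Complex.ofReal_im]
  have := (convex_Ioi (0 : ℝ)).is_const_of_fderivWithin_eq_zero (𝕜 := ℝ) (x := y) (y := 1)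
    (f := fun t : ℝ => (logPrimitive α δ 0 t).im)
    (fun t ht => (hd t ht).differentiableAt.differentiableWithinAt) (fun t ht => ?_) hy
    (mem_Ioi.2 one_pos)
  · simpa using this
  · rw [fderivWithin_of_isOpen isOpen_Ioi ht]
    ext
    simpa using (hd t ht).deriv

end LogPathIntegrals

/-! ### Curves with an endpoint at 0, on the boundary of the half-plane. -/

section LogPathsFromZero

open Set Filter Topology MeasureTheory

theorem exp_mem_fourthQuadrant {u v : ℝ} (hv : -(Real.pi / 2) ≤ v) (hv' : v ≤ 0) :
    Complex.exp (u + v * Complex.I) ∈ {z : ℂ | 0 ≤ z.re ∧ z.im ≤ 0 ∧ z ≠ 0} := by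
  refine ⟨?_, ?_, Complex.exp_ne_zero _⟩
  · rw [Complex.exp_re]
    simp only [Complex.add_re, Complex.ofReal_re, Complex.mul_re, Complex.I_re, mul_zero,
      Complex.ofReal_im, Complex.I_im, mul_one, sub_self, add_zero, Complex.add_im, Complex.mul_im,
      zero_add]
    exact mul_nonneg (Real.exp_pos u).le
      (Real.cos_nonneg_of_mem_Icc ⟨hv, by linarith [Real.pi_pos]⟩)
  · rw [Complex.exp_im]
    simp only [Complex.add_re, Complex.ofReal_re, Complex.mul_re, Complex.I_re, mul_zero,
      Complex.ofReal_im, Complex.I_im, mul_one, sub_self, add_zero, Complex.add_im, Complex.mul_im,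
      zero_add]
    exact mul_nonpos_of_nonneg_of_nonpos (Real.exp_pos u).le
      (Real.sin_nonpos_of_nonpos_of_neg_pi_le hv' (by linarith [Real.pi_pos]))

theorem tendsto_fourthQuadrant {γ : ℝ → ℂ} {l : Filter ℝ} (hγ : Tendsto γ l (𝓝 0))
    (hexp : ∀ᶠ t in l, ∃ u v : ℝ, γ t = Complex.exp (u + v * Complex.I) ∧
      -(Real.pi / 2) ≤ v ∧ v ≤ 0) :
    Tendsto γ l (𝓝[{z : ℂ | 0 ≤ z.re ∧ z.im ≤ 0 ∧ z ≠ 0}] 0) := by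
  refine tendsto_nhdsWithin_iff.2 ⟨hγ, ?_⟩
  filter_upwards [hexp] with t ⟨u, v, h, h1, h2⟩
  rw [h]
  exact exp_mem_fourthQuadrant h1 h2

theorem tendsto_norm_fourthQuadrant :
    Tendsto (fun z : ℂ => ‖z‖) (𝓝[{z : ℂ | 0 ≤ z.re ∧ z.im ≤ 0 ∧ z ≠ 0}] 0) (𝓝[>] 0) := by
  refine tendsto_nhdsWithin_iff.2 ⟨?_, ?_⟩
  · exact (tendsto_norm_zero (E := ℂ)).mono_left nhdsWithin_le_nhds
  · filter_upwards [self_mem_nhdsWithin] with z hz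
    exact norm_pos_iff.2 hz.2.2

/-- Replacing z by ‖z‖ costs o(1), so a limit along the positive axis is a limit in the whole closed
quadrant. -/
theorem tendsto_im_primitive_fourthQuadrant {k K : ℂ → ℂ} {c : ℝ}
    (hK : ∀ z ∈ belowDiagonal, HasDerivAt K (k z) z)
    (hk : Tendsto (fun w => w * k w) (𝓝[belowDiagonal] 0) (𝓝 0))
    (hc : Tendsto (fun t : ℝ => (K t).im) (𝓝[>] 0) (𝓝 c)) :
    Tendsto (fun z => (K z).im) (𝓝[{z : ℂ | 0 ≤ z.re ∧ z.im ≤ 0 ∧ z ≠ 0}] 0) (𝓝 c) := by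
  have h1 := (Complex.continuous_im.tendsto 0).comp (tendsto_primitive_sub_primitive_norm hK hk)
  have h2 := h1.add (hc.comp tendsto_norm_fourthQuadrant)
  simp only [Complex.zero_im, zero_add] at h2
  exact h2.congr fun z => by simp

theorem tendsto_im_logPrimitive_fourthQuadrant :
    Tendsto (fun z => (logPrimitive 1 0 0 z).im)
      (𝓝[{z : ℂ | 0 ≤ z.re ∧ z.im ≤ 0 ∧ z ≠ 0}] 0) (𝓝 (logPrimitive 1 0 0 1).im) := by
  refine tendsto_im_primitive_fourthQuadrant (hasDerivAt_logPrimitive 1 0 0) ?_ ?_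
  · simpa using tendsto_mul_logKernel
  · refine tendsto_const_nhds.congr' ?_
    filter_upwards [self_mem_nhdsWithin] with t ht
    exact (im_logPrimitive_ofReal 1 0 ht).symm

/-- γ = 2x / (x + I) runs from 0 to 1 - I, and γ - 1 = (x - I) / (x + I) has modulus 1, so again r =
0. The value at the start 0 is the one at 1. -/
theorem logPath_two_mul_div {q : ℝ}
    (hq : HasUnitIntegral (fun x =>
      ((Real.log (2 * x) - Real.log (1 + x ^ 2) / 2) ^ 2 - (Real.arctan x - Real.pi / 2) ^ 2)
        * (2 / (1 + x ^ 2))) q) :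
    q = (logPrimitive 1 0 0 (1 - Complex.I)).im - (logPrimitive 1 0 0 1).im := by
  have hexp : ∀ x ∈ Ioo (0 : ℝ) 1, (0 + 2 * (x : ℂ)) / (x + Complex.I) = Complex.exp
      ((Real.log (2 * x) - Real.log (1 + x ^ 2) / 2 : ℝ)
        + (Real.arctan x - Real.pi / 2 : ℝ) * Complex.I) := fun x hx => by
    rw [← ofReal_div_add_I_eq_exp (by linarith [hx.1])]
    simp
  have hv : ∀ x ∈ Ioo (0 : ℝ) 1, -(Real.pi / 2) ≤ Real.arctan x - Real.pi / 2 ∧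
      Real.arctan x - Real.pi / 2 < 0 := fun x hx => by
    have := arctan_mem_of_mem_Ioo hx
    constructor <;> linarith
  refine eq_sub_of_logPath (γ := fun t : ℝ => (0 + 2 * t) / (t + Complex.I))
    (r := fun x => 0) (s := fun x => 2 / (1 + x ^ 2)) hexp hv (fun x hx => ?_)
    (tendsto_im_logPrimitive_fourthQuadrant.comp (tendsto_fourthQuadrant ?_ ?_))
    (tendsto_im_logPrimitive_comp (continuousAt_div_add_I _ _ 1) ?_
      one_sub_I_mem_belowDiagonal)
    (hq.congr fun x _ => by ring)
  · apply hasDerivAt_div_add_I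
    have := one_add_sq_ne_zero x
    push_cast
    field_simp
    linear_combination (2 * Complex.I) * Complex.I_sq
  · have := (continuousAt_div_add_I 0 2 0).tendsto
    simp only [Complex.ofReal_zero, mul_zero, zero_add, zero_div] at this
    simp only [zero_add]
    exact this.mono_left nhdsWithin_le_nhds
  · filter_upwards [Ioo_mem_nhdsGT zero_lt_one] with x hx
    exact ⟨_, _, hexp x hx, (hv x hx).1, (hv x hx).2.le⟩
  · have := one_div_one_add_I
    simp only [Complex.ofReal_one, mul_one]
    linear_combination 2 * this

theorem logPath_neg_imaginary {q : ℝ}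
    (hq : HasUnitIntegral (fun x => (Real.log x ^ 2 - Real.pi ^ 2 / 4) * (1 / (1 + x ^ 2))
      - Real.pi * Real.log x * (x / (1 + x ^ 2))) q) :
    q = (logPrimitive 1 0 0 (-Complex.I)).im - (logPrimitive 1 0 0 1).im := by
  have hexp : ∀ x ∈ Ioo (0 : ℝ) 1, -Complex.I * (x : ℂ) = Complex.exp
      ((Real.log x : ℝ) + (-(Real.pi / 2) : ℝ) * Complex.I) := fun x hx => by
    rw [Complex.exp_add, ← Complex.ofReal_exp, Real.exp_log hx.1]
    push_cast
    rw [neg_mul, neg_mul, Complex.exp_neg, Complex.exp_pi_div_two_mul_I, Complex.inv_I]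
    ring
  have hd : ∀ x : ℝ, HasDerivAt (fun t : ℝ => -Complex.I * (t : ℂ)) (-Complex.I) x := fun x => by
    simpa using (hasDerivAt_ofReal' x).const_mul (-Complex.I)
  refine eq_sub_of_logPath (γ := fun t : ℝ => -Complex.I * t) (v := fun _ => -(Real.pi / 2))
    (r := fun x => x / (1 + x ^ 2)) (s := fun x => 1 / (1 + x ^ 2)) hexp
    (fun x hx => ⟨le_rfl, by linarith [Real.pi_pos]⟩) (fun x hx => ?_)
    (tendsto_im_logPrimitive_fourthQuadrant.comp (tendsto_fourthQuadrant ?_ ?_))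
    (tendsto_im_logPrimitive_comp (hd 1).continuousAt (by simp) neg_I_mem_belowDiagonal)
    (hq.congr fun x _ => by ring)
  · refine (hd x).congr_deriv ?_
    have := one_add_sq_ne_zero x
    push_cast
    field_simp
    linear_combination (x : ℂ) * Complex.I_sq
  · have := (hd 0).continuousAt.tendsto
    simp only [Complex.ofReal_zero, mul_zero] at this
    exact this.mono_left nhdsWithin_le_nhds
  · filter_upwards [Ioo_mem_nhdsGT zero_lt_one] with x hx
    exact ⟨_, _, hexp x hx, le_rfl, by linarith [Real.pi_pos]⟩

theorem im_ofReal_add_ofReal_mul_I (a b : ℝ) : ((a : ℂ) + b * Complex.I).im = b := by simp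

theorem im_sq_mul (u v r s : ℝ) :
    (((u : ℂ) + v * Complex.I) ^ 2 * (r + s * Complex.I)).im
      = (u ^ 2 - v ^ 2) * s + 2 * u * v * r := by
  rw [sq]
  simp only [Complex.mul_im, Complex.mul_re, Complex.add_re, Complex.add_im, Complex.ofReal_re,
    Complex.ofReal_im, Complex.I_re, Complex.I_im]
  ring

/-- On the positive axis the imaginary part of log² y / (y - I) is ln² y / (1 + y²). Integrating
from y to 1 and letting y → 0 gives the limit. -/
theorem tendsto_im_logSqPrimitive_ofReal {w : ℝ}
    (hw : HasUnitIntegral (fun x => Real.log x ^ 2 / (1 + x ^ 2)) w) :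
    Tendsto (fun t : ℝ => (logSqPrimitive t).im) (𝓝[>] 0) (𝓝 ((logSqPrimitive 1).im - w)) := by
  have hd : ∀ y : ℝ, 0 < y → HasDerivAt (fun t : ℝ => (logSqPrimitive t).im)
      (Real.log y ^ 2 / (1 + y ^ 2)) y := fun y hy => by
    refine hasDerivAt_im_primitive_comp hasDerivAt_logSqPrimitive (hasDerivAt_ofReal' y)
      (ofReal_mem_belowDiagonal hy) ?_
    have e : (y : ℂ) - Complex.I ≠ 0 := fun h => by simpa using congrArg Complex.im h
    have e2 : logSqKernel y * 1 = (Real.log y ^ 2 * y / (1 + y ^ 2) : ℝ)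
        + (Real.log y ^ 2 / (1 + y ^ 2) : ℝ) * Complex.I := by
      rw [logSqKernel, ← Complex.ofReal_log hy.le]
      have := one_add_sq_ne_zero y
      push_cast
      field_simp
      linear_combination ((Real.log y : ℂ) ^ 2) * Complex.I_sq
    rw [e2, im_ofReal_add_ofReal_mul_I]
  have hi := hw.1
  have hint : ∀ y ∈ Ioo (0 : ℝ) 1, (∫ x in (0 : ℝ)..y, Real.log x ^ 2 / (1 + x ^ 2))
      + ((logSqPrimitive 1).im - w) = (logSqPrimitive y).im := fun y hy => by
    have h1 : IntervalIntegrable (fun x => Real.log x ^ 2 / (1 + x ^ 2)) volume 0 y :=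
      hi.mono_set (by
        rw [uIcc_of_le hy.1.le, uIcc_of_le zero_le_one]; exact Icc_subset_Icc_right hy.2.le)
    have h2 : IntervalIntegrable (fun x => Real.log x ^ 2 / (1 + x ^ 2)) volume y 1 :=
      hi.mono_set (by
        rw [uIcc_of_le hy.2.le, uIcc_of_le zero_le_one]; exact Icc_subset_Icc_left hy.1.le)
    have h3 := intervalIntegral.integral_add_adjacent_intervals h1 h2
    rw [hw.2, intervalIntegral.integral_eq_sub_of_hasDerivAt (fun x hx => hd x ?_) h2] at h3
    · simp only [Complex.ofReal_one] at h3
      linarith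
    · rw [uIcc_of_le hy.2.le] at hx
      exact hy.1.trans_le hx.1
  have hcont := intervalIntegral.continuousOn_primitive_interval
    (f := fun x => Real.log x ^ 2 / (1 + x ^ 2)) (μ := volume) (a := 0) (b := 1)
    ((intervalIntegrable_iff' enorm_ne_top).1 hi)
  have h0 := (hcont 0 left_mem_uIcc).mono
    (show Ioo (0 : ℝ) 1 ⊆ uIcc 0 1 by rw [uIcc_of_le zero_le_one]; exact Ioo_subset_Icc_self)
  rw [ContinuousWithinAt, intervalIntegral.integral_same, nhdsWithin_Ioo_eq_nhdsGT zero_lt_one]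
    at h0
  have h4 := h0.add_const ((logSqPrimitive 1).im - w)
  rw [zero_add] at h4
  refine h4.congr' ?_
  filter_upwards [Ioo_mem_nhdsGT zero_lt_one] with y hy using hint y hy

/-- On γ = (1 - x) / (1 + x I), γ - 1 and γ - I are constant multiples of x / (1 + x I) and 1 / (1 +
x I), so dγ / (γ - 1) - dγ / (γ - I) = dx / x. Hence `q` is the imaginary part of the integral of
log² u (1 / (u - 1) - 1 / (u - I)) from 1 to 0. Compared with the real segment, the first kernel
contributes nothing and the second contributes `w`. -/
theorem logPath_one_sub_div {q w : ℝ}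
    (hw : HasUnitIntegral (fun x => Real.log x ^ 2 / (1 + x ^ 2)) w)
    (hq : HasUnitIntegral (fun x => -2 * (Real.log (1 - x) - Real.log (1 + x ^ 2) / 2)
      * Real.arctan x / x) q) : q = w := by
  have hexp : ∀ x ∈ Ioo (0 : ℝ) 1, (1 + (-1) * (x : ℂ)) / (1 + x * Complex.I) = Complex.exp
      ((Real.log (1 - x) - Real.log (1 + x ^ 2) / 2 : ℝ)
        + (-Real.arctan x : ℝ) * Complex.I) := fun x hx => by
    rw [← ofReal_div_one_add_mul_I_eq_exp (by linarith [hx.2])]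
    push_cast
    ring
  have hP : ∀ x ∈ Ioo (0 : ℝ) 1, HasDerivAt (fun t : ℝ => (logPrimitive 1 0 0
      ((1 + (-1) * t) / (1 + t * Complex.I))).im) _ x := fun x hx => by
    refine hasDerivAt_im_logPrimitive_comp
      (γ := fun t : ℝ => (1 + (-1) * t) / (1 + t * Complex.I))
      (r := 1 / (x * (1 + x ^ 2))) (s := -1 / (1 + x ^ 2)) (hexp x hx) ?_ ?_ ?_
    · have := arctan_mem_of_mem_Ioo hx
      linarith
    · have := arctan_mem_of_mem_Ioo hx
      linarith
    · apply hasDerivAt_div_one_add_mul_I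
      have := one_add_sq_ne_zero x
      have : (x : ℂ) ≠ 0 := Complex.ofReal_ne_zero.2 hx.1.ne'
      push_cast
      field_simp
      linear_combination (-x ^ 3 * (1 + Complex.I)) * Complex.I_sq
  have hR : ∀ x ∈ Ioo (0 : ℝ) 1, HasDerivAt (fun t : ℝ => (logSqPrimitive
      ((1 + (-1) * t) / (1 + t * Complex.I))).im)
      (((Real.log (1 - x) - Real.log (1 + x ^ 2) / 2) ^ 2 - Real.arctan x ^ 2) * (-1 / (1 + x ^ 2))
        + 2 * (Real.log (1 - x) - Real.log (1 + x ^ 2) / 2) * (-Real.arctan x)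
          * (-x / (1 + x ^ 2))) x := fun x hx => by
    have hθ := arctan_mem_of_mem_Ioo hx
    have hmem : (1 + (-1) * (x : ℂ)) / (1 + x * Complex.I) ∈ belowDiagonal := by
      rw [hexp x hx]
      exact exp_mem_belowDiagonal (by linarith) (by linarith)
    refine hasDerivAt_im_primitive_comp hasDerivAt_logSqPrimitive
      (γ := fun t : ℝ => (1 + (-1) * t) / (1 + t * Complex.I))
      (hasDerivAt_div_one_add_mul_I (c := Complex.I)
        (w := (-x / (1 + x ^ 2) : ℝ) + (-1 / (1 + x ^ 2) : ℝ) * Complex.I) x ?_) hmem ?_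
    · have := one_add_sq_ne_zero x
      push_cast
      field_simp
      linear_combination (x - 1 - 2 * Complex.I * x - Complex.I * x ^ 3
        - x ^ 2 * (Complex.I ^ 2 + 2)) * Complex.I_sq
    · have hne : (1 + (-1) * (x : ℂ)) / (1 + x * Complex.I) - Complex.I ≠ 0 := fun h => by
        rw [sub_eq_zero.1 h, mem_belowDiagonal] at hmem
        simp at hmem
        linarith
      rw [logSqKernel, log_eq_of_eq_exp (hexp x hx) (by linarith) (by linarith),
        div_mul_eq_mul_div, mul_comm (_ + _ * Complex.I) (_ - Complex.I), mul_left_comm,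
        mul_div_cancel_left₀ _ hne, im_sq_mul]
      ring
  have h0 : Tendsto (fun t : ℝ => (1 + (-1) * (t : ℂ)) / (1 + t * Complex.I)) (𝓝[<] 1)
      (𝓝[{z : ℂ | 0 ≤ z.re ∧ z.im ≤ 0 ∧ z ≠ 0}] 0) := by
    refine tendsto_fourthQuadrant ?_ ?_
    · have := (continuousAt_div_one_add_mul_I 1 (-1) 1).tendsto
      simp only [Complex.ofReal_one, mul_one, add_neg_cancel, zero_div] at this
      exact this.mono_left nhdsWithin_le_nhds
    · filter_upwards [Ioo_mem_nhdsLT zero_lt_one] with x hx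
      have := arctan_mem_of_mem_Ioo hx
      exact ⟨_, _, hexp x hx, by linarith, by linarith⟩
  have key := hq.eq_sub_of_hasDerivAt
    (fun x hx => ((hP x hx).sub (hR x hx)).congr_deriv ?_)
    ((tendsto_im_logPrimitive_comp (continuousAt_div_one_add_mul_I 1 (-1) 0) (by simp)
      one_mem_belowDiagonal).sub (tendsto_im_primitive_comp hasDerivAt_logSqPrimitive
        (continuousAt_div_one_add_mul_I 1 (-1) 0) (by simpa using one_mem_belowDiagonal)))
    ((tendsto_im_logPrimitive_fourthQuadrant.comp h0).sub
      ((tendsto_im_primitive_fourthQuadrant hasDerivAt_logSqPrimitive tendsto_mul_logSqKernel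
        (tendsto_im_logSqPrimitive_ofReal hw)).comp h0))
  · rw [key]
    simp
  · have h0 := hx.1.ne'
    have : 1 + x ^ 2 ≠ 0 := by positivity
    field_simp
    ring

end LogPathsFromZero

/-! ### The integrals needed, and the linear relations between them. -/

section Evaluations

open Set Filter Topology MeasureTheory

theorem tendsto_log_mul_of_abs_le {g : ℝ → ℝ} (hg : ∀ x ∈ Ioo (0 : ℝ) 1, |g x| ≤ x) :
    Tendsto (fun x => Real.log x * g x) (𝓝[>] 0) (𝓝 0) := by
  have h := (tendsto_log_mul_rpow_nhdsGT_zero (r := 1) one_pos).abs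
  rw [abs_zero] at h
  refine squeeze_zero_norm' ?_ h
  filter_upwards [Ioo_mem_nhdsGT zero_lt_one] with x hx
  rw [Real.rpow_one, Real.norm_eq_abs, abs_mul, abs_mul, abs_of_pos hx.1]
  exact mul_le_mul_of_nonneg_left (hg x hx) (abs_nonneg _)

theorem tendsto_nhdsLT_of_continuousAt {f : ℝ → ℝ} {a c : ℝ} (hf : ContinuousAt f a)
    (h : f a = c) : Tendsto f (𝓝[<] a) (𝓝 c) := by
  rw [← h]; exact hf.tendsto.mono_left nhdsWithin_le_nhds

theorem abs_arctan_le {x : ℝ} (hx : x ∈ Ioo (0 : ℝ) 1) : |Real.arctan x| ≤ x := by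
  rw [abs_of_nonneg (arctan_nonneg_of_nonneg hx.1.le)]
  exact arctan_le_self_of_nonneg hx.1.le

theorem abs_log_one_add_sq_le {x : ℝ} (hx : x ∈ Ioo (0 : ℝ) 1) : |Real.log (1 + x ^ 2)| ≤ x := by
  rw [abs_of_nonneg log_one_add_sq_nonneg]
  nlinarith [log_one_add_sq_le_sq (x := x), hx.1, hx.2]

theorem hasDerivAt_log_one_add_sq (x : ℝ) :
    HasDerivAt (fun t : ℝ => Real.log (1 + t ^ 2)) (2 * x / (1 + x ^ 2)) x := by
  have h : HasDerivAt (fun t : ℝ => 1 + t ^ 2) (2 * x) x := by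
    simpa using (hasDerivAt_pow 2 x).const_add 1
  exact h.log (by positivity)

theorem hasUnitIntegral_log_div :
    HasUnitIntegral (fun x => Real.log x / (1 + x ^ 2)) (-catalanConst) := by
  have h := HasUnitIntegral.of_intervalIntegrable intervalIntegrable_log_div
  have h2 := (h.add hasUnitIntegral_arctan_div).eq_sub_of_hasDerivAt
    (F := fun x => Real.log x * Real.arctan x) (a := 0) (b := 0) (fun x hx => ?_)
    (tendsto_log_mul_of_abs_le fun x hx => abs_arctan_le hx)
    (tendsto_nhdsLT_of_continuousAt (ContinuousAt.mul (Real.continuousAt_log one_ne_zero)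
      Real.continuous_arctan.continuousAt) (by simp))
  · refine ⟨h.1, ?_⟩
    linarith
  · refine ((Real.hasDerivAt_log hx.1.ne').mul (Real.hasDerivAt_arctan x)).congr_deriv ?_
    ring

theorem hasUnitIntegral_mul_log_div :
    HasUnitIntegral (fun x => x * Real.log x / (1 + x ^ 2)) (-(Real.pi ^ 2 / 48)) := by
  have h := HasUnitIntegral.of_intervalIntegrable intervalIntegrable_mul_log_div
  have h2 := ((h.const_mul 2).add hasUnitIntegral_log_one_add_sq_div_self).eq_sub_of_hasDerivAt
    (F := fun x => Real.log x * Real.log (1 + x ^ 2)) (a := 0) (b := 0) (fun x hx => ?_)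
    (tendsto_log_mul_of_abs_le fun x hx => abs_log_one_add_sq_le hx)
    (tendsto_nhdsLT_of_continuousAt (ContinuousAt.mul (Real.continuousAt_log one_ne_zero)
      (hasDerivAt_log_one_add_sq 1).continuousAt) (by simp))
  · refine ⟨h.1, ?_⟩
    linarith
  · refine ((Real.hasDerivAt_log hx.1.ne').mul (hasDerivAt_log_one_add_sq x)).congr_deriv ?_
    ring

/-- The integrands combine to the derivative of ln x · arctan x · ln (1 + x²), which vanishes at
both ends. -/
theorem integral_add_integral_add_two_mul_integral_eq_zero {c d f : ℝ}
    (hc : HasUnitIntegral (fun x => Real.arctan x * Real.log (1 + x ^ 2) / x) c)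
    (hd : HasUnitIntegral (fun x => x * Real.arctan x * Real.log x / (1 + x ^ 2)) d)
    (hf : HasUnitIntegral (fun x => Real.log x * Real.log (1 + x ^ 2) / (1 + x ^ 2)) f) :
    f + c + 2 * d = 0 := by
  have h2 := ((hf.add hc).add (hd.const_mul 2)).eq_sub_of_hasDerivAt
    (F := fun x => Real.log x * (Real.arctan x * Real.log (1 + x ^ 2))) (a := 0) (b := 0)
    (fun x hx => ?_)
    (tendsto_log_mul_of_abs_le fun x hx => ?_)
    (tendsto_nhdsLT_of_continuousAt (ContinuousAt.mul (Real.continuousAt_log one_ne_zero)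
      (Real.continuous_arctan.continuousAt.mul (hasDerivAt_log_one_add_sq 1).continuousAt))
      (by simp))
  · rw [h2, sub_zero]
  · refine ((Real.hasDerivAt_log hx.1.ne').mul
      ((Real.hasDerivAt_arctan x).mul (hasDerivAt_log_one_add_sq x))).congr_deriv ?_
    simp only [Pi.mul_apply]
    ring
  · rw [abs_mul]
    exact (mul_le_of_le_one_right (abs_nonneg _) (abs_log_one_add_sq_le_one hx)).trans
      (abs_arctan_le hx)

theorem four_mul_integral_add_integral_eq {e y : ℝ}
    (he : HasUnitIntegral (fun x => x * Real.arctan x * Real.log (1 + x ^ 2) / (1 + x ^ 2)) e)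
    (hy : HasUnitIntegral (fun x => Real.log (1 + x ^ 2) ^ 2 / (1 + x ^ 2)) y) :
    4 * e + y = Real.pi / 4 * Real.log 2 ^ 2 := by
  have hF : ∀ x : ℝ, HasDerivAt (fun x => Real.arctan x * Real.log (1 + x ^ 2) ^ 2) _ x :=
    fun x => (Real.hasDerivAt_arctan x).mul ((hasDerivAt_log_one_add_sq x).pow 2)
  have h2 := ((he.const_mul 4).add hy).eq_sub_of_hasDerivAt
    (fun x hx => (hF x).congr_deriv ?_)
    ((hF 0).continuousAt.tendsto.mono_left nhdsWithin_le_nhds)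
    ((hF 1).continuousAt.tendsto.mono_left nhdsWithin_le_nhds)
  · rw [h2]
    norm_num
  · simp
    ring

theorem im_logPrimitive_neg_I :
    (logPrimitive 1 0 0 (-Complex.I)).im - (logPrimitive 1 0 0 1).im = Real.pi ^ 3 / 48 := by
  rw [← logPath_unit_arc (((hasUnitIntegral_arctan_pow_div 2).const_mul 4).congr
    fun x _ => by ring)]
  push_cast
  ring

theorem im_logPrimitive_pi_neg_I :
    (logPrimitive 1 0 Real.pi (-Complex.I)).im - (logPrimitive 1 0 Real.pi 1).im
      = -(Real.pi ^ 3 / 24) := by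
  rw [← logPath_unit_arc ((((hasUnitIntegral_arctan_pow_div 2).const_mul 4).add
    ((hasUnitIntegral_arctan_pow_div 1).const_mul (-2 * Real.pi))).congr fun x _ => by ring)]
  push_cast
  ring

/-- The segment from 0 to -I is compared with the unit arc from 1 to -I, the imaginary part being
the same at 0 and 1. -/
theorem hasUnitIntegral_log_sq_div :
    HasUnitIntegral (fun x => Real.log x ^ 2 / (1 + x ^ 2)) (Real.pi ^ 3 / 16) := by
  have h := HasUnitIntegral.of_intervalIntegrable intervalIntegrable_log_sq_div
  have h2 := logPath_neg_imaginary (((h.add ((hasUnitIntegral_arctan_pow_div 0).const_mul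
    (-(Real.pi ^ 2 / 4)))).add (hasUnitIntegral_mul_log_div.const_mul (-Real.pi))).congr
      fun x _ => by ring)
  rw [im_logPrimitive_neg_I] at h2
  refine ⟨h.1, ?_⟩
  push_cast at h2
  linarith

/-- The kernel log u / (u - 1) is integrated to 1 - I from 1 and from 2; the vertical segment yields
-G. -/
theorem hasUnitIntegral_log_one_add_sq_div :
    HasUnitIntegral (fun x => Real.log (1 + x ^ 2) / (1 + x ^ 2))
      (Real.pi / 2 * Real.log 2 - catalanConst) := by
  have h := HasUnitIntegral.of_intervalIntegrable intervalIntegrable_log_one_add_sq_div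
  have h1 := logPath_vertical (α := 0) (δ := 1) (β := 0)
    ((hasUnitIntegral_arctan_div.const_mul (-1)).congr fun x _ => by ring)
  have h2 := logPath_two_div (α := 0) (δ := 1) (β := 0)
    ((((hasUnitIntegral_arctan_pow_div 0).const_mul (-2 * Real.log 2)).add h).congr
      fun x _ => by ring)
  have h3 := im_logPrimitive_ofReal 0 1 two_pos
  push_cast at h2 h3
  refine ⟨h.1, ?_⟩
  linarith

theorem im_logPrimitive_one_sub_I {c : ℝ}
    (hc : HasUnitIntegral (fun x => Real.arctan x * Real.log (1 + x ^ 2) / x) c) :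
    (logPrimitive 1 0 0 (1 - Complex.I)).im - (logPrimitive 1 0 0 1).im = -c := by
  rw [← logPath_vertical ((hc.const_mul (-1)).congr fun x _ => by ring)]
  ring

/-- The two curves of `logPath_one_add_div` are replaced by the vertical segment, for β = 0 and β =
π, and the unit arc for β = π; all π³ terms cancel. -/
theorem two_mul_integral_arctan_mul_log_one_add_div_eq {a c : ℝ}
    (ha : HasUnitIntegral (fun x => Real.arctan x * Real.log (1 + x) / x) a)
    (hc : HasUnitIntegral (fun x => Real.arctan x * Real.log (1 + x ^ 2) / x) c) : 2 * a = 3 * c := by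
  have h1 := im_logPrimitive_one_sub_I hc
  have h2 := logPath_vertical (α := 1) (δ := 0) (β := Real.pi) (((hc.const_mul (-1)).add
    (hasUnitIntegral_log_one_add_sq_div_self.const_mul (Real.pi / 2))).congr fun x _ => by ring)
  have h3 := logPath_one_add_div ((((ha.const_mul (-2)).add hc).add
    ((hasUnitIntegral_arctan_pow_div 0).const_mul (Real.pi ^ 2 / 4))).congr fun x _ => by ring)
  have h4 := im_logPrimitive_pi_neg_I
  push_cast at h3
  linarith

theorem two_mul_integral_arctan_mul_log_one_sub_div_eq {b c : ℝ}
    (hb : HasUnitIntegral (fun x => Real.arctan x * Real.log (1 - x) / x) b)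
    (hc : HasUnitIntegral (fun x => Real.arctan x * Real.log (1 + x ^ 2) / x) c) : 2 * b = c - Real.pi ^ 3 / 16 := by
  have h := logPath_one_sub_div hasUnitIntegral_log_sq_div (((hb.const_mul (-2)).add hc).congr
    fun x _ => by ring)
  linarith

/-- The curves from 1 and from 2 to 1 - I are compared for log² u / (u - 1); expanding (ln 2 - ln (1
+ x²) / 2)² produces y. -/
theorem integral_arctan_mul_log_one_add_sq_div_eq {c y : ℝ}
    (hc : HasUnitIntegral (fun x => Real.arctan x * Real.log (1 + x ^ 2) / x) c)
    (hy : HasUnitIntegral (fun x => Real.log (1 + x ^ 2) ^ 2 / (1 + x ^ 2)) y) :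
    c = -(Real.pi / 2 * Real.log 2 ^ 2) + 2 * catalanConst * Real.log 2 + y / 2
      - Real.pi ^ 3 / 96 := by
  have h1 := im_logPrimitive_one_sub_I hc
  have h2 := logPath_two_div (α := 1) (δ := 0) (β := 0)
    ((((((hasUnitIntegral_arctan_pow_div 0).const_mul (-2 * Real.log 2 ^ 2)).add
      (hasUnitIntegral_log_one_add_sq_div.const_mul (2 * Real.log 2))).add
      (hy.const_mul (-(1 / 2)))).add ((hasUnitIntegral_arctan_pow_div 2).const_mul 2)).congr
      fun x _ => by ring)
  have h3 := im_logPrimitive_ofReal 1 0 two_pos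
  push_cast at h2 h3
  linarith

/-- The curve 2x / (x + I) is compared with the vertical segment. Expanding the square of ln 2 + ln
x - ln (1 + x²) / 2 gives f and y, and the previous relation eliminates y. -/
theorem integral_log_mul_log_one_add_sq_sub_eq {c f y : ℝ}
    (hc : HasUnitIntegral (fun x => Real.arctan x * Real.log (1 + x ^ 2) / x) c)
    (hf : HasUnitIntegral (fun x => Real.log x * Real.log (1 + x ^ 2) / (1 + x ^ 2)) f)
    (hy : HasUnitIntegral (fun x => Real.log (1 + x ^ 2) ^ 2 / (1 + x ^ 2)) y) :
    f - c = Real.pi ^ 3 / 32 - 2 * catalanConst * Real.log 2 := by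
  have h1 := im_logPrimitive_one_sub_I hc
  have h2 := integral_arctan_mul_log_one_add_sq_div_eq hc hy
  have h3 := logPath_two_mul_div
    ((((((((((hasUnitIntegral_arctan_pow_div 0).const_mul
      (2 * Real.log 2 ^ 2 - Real.pi ^ 2 / 2)).add
      (hasUnitIntegral_log_sq_div.const_mul 2)).add (hy.const_mul (1 / 2))).add
      (hasUnitIntegral_log_div.const_mul (4 * Real.log 2))).add
      (hasUnitIntegral_log_one_add_sq_div.const_mul (-2 * Real.log 2))).add
      (hf.const_mul (-2))).add ((hasUnitIntegral_arctan_pow_div 2).const_mul (-2))).add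
      ((hasUnitIntegral_arctan_pow_div 1).const_mul (2 * Real.pi))).congr fun x hx => by
        rw [Real.log_mul two_ne_zero hx.1.ne']
        ring)
  push_cast at h3
  linarith

end Evaluations

/-! ### The seventeen identities, by linear elimination. -/

theorem mainTheorem12 :
    (IntervalIntegrable (fun x : ℝ => Real.arctan x * Real.log (1 + x) / x)
      MeasureTheory.volume 0 1) ∧
    (IntervalIntegrable (fun x : ℝ => Real.arctan x * Real.log (1 - x) / x)
      MeasureTheory.volume 0 1) ∧
    (IntervalIntegrable (fun x : ℝ => Real.arctan x * Real.log (1 + x ^ 2) / x)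
      MeasureTheory.volume 0 1) ∧
    (IntervalIntegrable (fun x : ℝ => x * Real.arctan x * Real.log x / (1 + x ^ 2))
      MeasureTheory.volume 0 1) ∧
    (IntervalIntegrable (fun x : ℝ => x * Real.arctan x * Real.log (1 + x ^ 2) / (1 + x ^ 2))
      MeasureTheory.volume 0 1) ∧
    (IntervalIntegrable (fun x : ℝ => Real.log x * Real.log (1 + x ^ 2) / (1 + x ^ 2))
      MeasureTheory.volume 0 1) ∧
    (2 * (∫ x in (0 : ℝ)..1, Real.arctan x * Real.log (1 + x) / x)
      + (∫ x in (0 : ℝ)..1, Real.arctan x * Real.log (1 + x ^ 2) / x)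
      + 4 * (∫ x in (0 : ℝ)..1, x * Real.arctan x * Real.log x / (1 + x ^ 2))
      = 4 * (catalanConst * Real.log 2) - Real.pi ^ 3 / 16) ∧
    ((∫ x in (0 : ℝ)..1, Real.arctan x * Real.log (1 + x ^ 2) / x)
      - 2 * (∫ x in (0 : ℝ)..1, x * Real.arctan x * Real.log (1 + x ^ 2) / (1 + x ^ 2))
      + 2 * (∫ x in (0 : ℝ)..1, x * Real.arctan x * Real.log x / (1 + x ^ 2))
      = 3 / 8 * (Real.pi * Real.log 2 ^ 2) - Real.pi ^ 3 / 48) ∧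
    ((∫ x in (0 : ℝ)..1, Real.arctan x * Real.log (1 - x) / x)
      + (∫ x in (0 : ℝ)..1, Real.arctan x * Real.log (1 + x) / x)
      + 2 * (∫ x in (0 : ℝ)..1, x * Real.arctan x * Real.log x / (1 + x ^ 2))
      = 2 * (catalanConst * Real.log 2) - Real.pi ^ 3 / 16) ∧
    ((∫ x in (0 : ℝ)..1, Real.arctan x * Real.log (1 + x ^ 2) / x)
      + 2 * (∫ x in (0 : ℝ)..1, x * Real.arctan x * Real.log (1 + x ^ 2) / (1 + x ^ 2))
      = 2 * (catalanConst * Real.log 2) - 3 / 8 * (Real.pi * Real.log 2 ^ 2) - Real.pi ^ 3 / 96) ∧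
    ((32 / 3) * (∫ x in (0 : ℝ)..1, Real.arctan x * Real.log (1 + x) / x)
      - 32 * (∫ x in (0 : ℝ)..1, Real.arctan x * Real.log (1 - x) / x)
      = Real.pi ^ 3) ∧
    (3 * (∫ x in (0 : ℝ)..1, Real.arctan x * Real.log (1 + x ^ 2) / x)
      - 2 * (∫ x in (0 : ℝ)..1, Real.arctan x * Real.log (1 + x) / x)
      = 0) ∧
    (16 * (∫ x in (0 : ℝ)..1, Real.arctan x * Real.log (1 + x ^ 2) / x)
      - 32 * (∫ x in (0 : ℝ)..1, Real.arctan x * Real.log (1 - x) / x)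
      = Real.pi ^ 3) ∧
    (6 * (∫ x in (0 : ℝ)..1, x * Real.arctan x * Real.log x / (1 + x ^ 2))
      + 4 * (∫ x in (0 : ℝ)..1, Real.arctan x * Real.log (1 + x) / x)
      = -3 / 32 * Real.pi ^ 3 + 6 * (catalanConst * Real.log 2)) ∧
    ((∫ x in (0 : ℝ)..1, x * Real.arctan x * Real.log x / (1 + x ^ 2))
      + (∫ x in (0 : ℝ)..1, Real.arctan x * Real.log (1 + x ^ 2) / x)
      = -Real.pi ^ 3 / 64 + (catalanConst * Real.log 2)) ∧
    ((∫ x in (0 : ℝ)..1, x * Real.arctan x * Real.log x / (1 + x ^ 2))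
      + 2 * (∫ x in (0 : ℝ)..1, Real.arctan x * Real.log (1 - x) / x)
      = -5 / 64 * Real.pi ^ 3 + (catalanConst * Real.log 2)) ∧
    (3 * (∫ x in (0 : ℝ)..1, Real.log x * Real.log (1 + x ^ 2) / (1 + x ^ 2))
      - 2 * (∫ x in (0 : ℝ)..1, Real.arctan x * Real.log (1 + x) / x)
      = -6 * (catalanConst * Real.log 2) + 3 / 32 * Real.pi ^ 3) ∧
    ((∫ x in (0 : ℝ)..1, Real.log x * Real.log (1 + x ^ 2) / (1 + x ^ 2))
      - (∫ x in (0 : ℝ)..1, Real.arctan x * Real.log (1 + x ^ 2) / x)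
      = -2 * (catalanConst * Real.log 2) + Real.pi ^ 3 / 32) ∧
    ((∫ x in (0 : ℝ)..1, Real.log x * Real.log (1 + x ^ 2) / (1 + x ^ 2))
      - 2 * (∫ x in (0 : ℝ)..1, Real.arctan x * Real.log (1 - x) / x)
      = -2 * (catalanConst * Real.log 2) + 3 / 32 * Real.pi ^ 3) ∧
    ((∫ x in (0 : ℝ)..1, Real.arctan x * Real.log (1 + x) / x)
      + 3 * (∫ x in (0 : ℝ)..1, x * Real.arctan x * Real.log (1 + x ^ 2) / (1 + x ^ 2))
      = 3 * (catalanConst * Real.log 2) - Real.pi ^ 3 / 64 - 9 / 16 * (Real.pi * Real.log 2 ^ 2)) ∧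
    ((∫ x in (0 : ℝ)..1, Real.arctan x * Real.log (1 - x) / x)
      + (∫ x in (0 : ℝ)..1, x * Real.arctan x * Real.log (1 + x ^ 2) / (1 + x ^ 2))
      = (catalanConst * Real.log 2) - 7 / 192 * Real.pi ^ 3 - 3 / 16 * (Real.pi * Real.log 2 ^ 2)) ∧
    ((∫ x in (0 : ℝ)..1, Real.log x * Real.log (1 + x ^ 2) / (1 + x ^ 2))
      + (∫ x in (0 : ℝ)..1, x * Real.arctan x * Real.log x / (1 + x ^ 2))
      = -(catalanConst * Real.log 2) + Real.pi ^ 3 / 64) ∧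
    (2 * (∫ x in (0 : ℝ)..1, x * Real.arctan x * Real.log (1 + x ^ 2) / (1 + x ^ 2))
      - (∫ x in (0 : ℝ)..1, x * Real.arctan x * Real.log x / (1 + x ^ 2))
      = (catalanConst * Real.log 2) + Real.pi ^ 3 / 192 - 3 / 8 * (Real.pi * Real.log 2 ^ 2)) := by
  have ha := HasUnitIntegral.of_intervalIntegrable
    intervalIntegrable_arctan_mul_log_one_add_div
  have hb := HasUnitIntegral.of_intervalIntegrable
    intervalIntegrable_arctan_mul_log_one_sub_div
  have hc := HasUnitIntegral.of_intervalIntegrable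
    intervalIntegrable_arctan_mul_log_one_add_sq_div
  have hd := HasUnitIntegral.of_intervalIntegrable intervalIntegrable_mul_arctan_mul_log_div
  have he := HasUnitIntegral.of_intervalIntegrable
    intervalIntegrable_mul_arctan_mul_log_one_add_sq_div
  have hf := HasUnitIntegral.of_intervalIntegrable intervalIntegrable_log_mul_log_one_add_sq_div
  have hy := HasUnitIntegral.of_intervalIntegrable intervalIntegrable_log_one_add_sq_sq_div
  -- Six relations in seven unknowns: everything is determined by c, and c (with y) drops out of
  -- each identity.
  have h1 := two_mul_integral_arctan_mul_log_one_add_div_eq ha hc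
  have h2 := two_mul_integral_arctan_mul_log_one_sub_div_eq hb hc
  have h3 := integral_arctan_mul_log_one_add_sq_div_eq hc hy
  have h4 := integral_log_mul_log_one_add_sq_sub_eq hc hf hy
  have h5 := integral_add_integral_add_two_mul_integral_eq_zero hc hd hf
  have h6 := four_mul_integral_add_integral_eq he hy
  refine ⟨ha.1, hb.1, hc.1, hd.1, he.1, hf.1, ?_, ?_, ?_, ?_, ?_, ?_, ?_, ?_, ?_, ?_, ?_, ?_,
    ?_, ?_, ?_, ?_, ?_⟩ <;> linarith
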